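/- Identify $\mathbb R^2$ with $\mathbb C$. Let $0<r<d$, $c=\sqrt{d^2-r^2}$, $\Omega=\{|z-id|<r\}$, and let $\Phi(z)=\dfrac{z+ic}{z-ic}$. Let $h_0:\mathbb R\to\mathbb R$ be a function of class $C^{1,\eta}$ for some $\eta>0$ with support in some $[-R,R]$, and for $\delta>0$ let $\mathbb H_\delta=\{z:\operatorname{Im}z<\delta h_0(\operatorname{Re}z)\}$. Put $D_1=\Phi(\mathbb H_\delta)$ and $D_2=\Phi\big((\mathbb C\cup\{\infty\})\setminus\overline\Omega\big)$, with $\Phi(\infty)=1$ (so $D_2=\{|\zeta|<e^s\}$, where $s>0$ and $\sinh s=\sqrt{(d/r)^2-1}$). Let $\sigma_j$ be arclength on $\partial D_j$, $\nu_j$ the outward unit normal of $D_j$, $\Gamma(x,y)=\frac1{2\pi}\ln|x-y|$, and, for $\varphi\in L^2(\partial D_j;\mathbb C)$, $$\mathcal S_{D_j}[\varphi](x)=\int_{\partial D_j}\Gamma(x,y)\varphi(y)\,d\sigma_j(y),\qquad \mathcal K^*_{D_j}[\varphi](x)=\int_{\partial D_j}\frac{\partial\Gamma}{\partial\nu_j(x)}(x,y)\varphi(y)\,d\sigma_j(y).$$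 For $a\in\mathbb R^2$ let $u^i(x)=-a\cdot x$ and $\tilde u^i=u^i\circ\Phi^{-1}$. For $\varepsilon_-,\varepsilon_+>0$ with $\varepsilon_-\ne\varepsilon_+$ and $\varepsilon_c\in\mathbb C$ with $\varepsilon_c\neq\varepsilon_+$ let $$\lambda_{-+}=\frac{\varepsilon_-+\varepsilon_+}{2(\varepsilon_--\varepsilon_+)},\qquad \lambda_{+c}=\frac{\varepsilon_++\varepsilon_c}{2(\varepsilon_+-\varepsilon_c)}.$$ There is $\delta_0>0$, depending only on $d,r,h_0$, such that for all $0<\delta<\delta_0$ and all such $\varepsilon_\pm$, $\varepsilon_c$ and $a$ the following hold. The operator $\lambda_{-+}I-\mathcal K^*_{D_1}:L^2(\partial D_1)\to L^2(\partial D_1)$ is well defined and bijective. If $\phi_1\in L^2(\partial D_1)$ and $\phi_2\in L^2(\partial D_2)$ satisfy the coupled system $$(\lambda_{-+}I-\mathcal K_{D_1}^*)[\phi_1]=\frac{\partial}{\partial\nu_1}\big(\tilde u^i+\mathcal S_{D_2}[\phi_2]\big)\ \text{ on }\partial D_1,\qquad(\lambda_{+c}I-\mathcal K_{D_2}^*)[\phi_2]=\frac{\partial}{\partial\nu_2}\big(\tilde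 u^i+\mathcal S_{D_1}[\phi_1]\big)\ \text{ on }\partial D_2$$ almost everywhere, then $\frac{\partial\tilde u^i}{\partial\nu_1}$ and $\frac{\partial \mathcal S_{D_2}[\phi_2]}{\partial\nu_1}$ belong to $L^2(\partial D_1)$, and $$(\lambda_{+c}I-\mathcal A)[\phi_2]=\frac{\partial\tilde u_{D_1}}{\partial\nu_2}\quad\text{a.e. on }\partial D_2,$$ where $$\mathcal A[\phi_2]=\mathcal K^*_{D_2}[\phi_2]+\frac{\partial}{\partial\nu_2}\mathcal S_{D_1}(\lambda_{-+}I-\mathcal K^*_{D_1})^{-1}\Big[\frac{\partial\mathcal S_{D_2}[\phi_2]}{\partial\nu_1}\Big],\qquad \tilde u_{D_1}=\tilde u^i+\mathcal S_{D_1}(\lambda_{-+}I-\mathcal K^*_{D_1})^{-1}\Big[\frac{\partial\tilde u^i}{\partial\nu_1}\Big],$$ and $\tilde u_{D_1}$ and $\mathcal S_{D_1}(\lambda_{-+}I-\mathcal K^*_{D_1})^{-1}\big[\frac{\partial\mathcal S_{D_2}[\phi_2]}{\partial\nu_1}\big]$ are differentiable at every point of $\partial D_2$. -/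

import Mathlib

open MeasureTheory Filter Topology

namespace Plasmon

noncomputable section

/-! ### Layer potentials in the plane, which is identified with `ℂ` -/

/-- The fundamental solution of the Laplacian in the plane, `Γ(x, y) = (1/2π) ln |x - y|`. -/
def fundSol (x y : ℂ) : ℝ := 1 / (2 * Real.pi) * Real.log ‖x - y‖

/-- A parametrised planar curve: the restriction of `γ` to the parameter set `I`.  It describes the
boundary of a domain, traversed once in the positive sense (the domain lies on the left); what this
means is spelled out in `Curve.IsBoundaryOf`. -/
structure Curve where
  γ : ℝ → ℂ
  I : Set ℝ

namespace Curve

variable (C : Curve)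

/-- The arclength measure `dσ` of the curve, `dσ = |γ'(t)| dt` carried to the plane by `γ`. -/
def σ : Measure ℂ :=
  Measure.map C.γ ((volume.restrict C.I).withDensity fun t => ENNReal.ofReal ‖deriv C.γ t‖)

/-- The unit normal on the right of the curve at the point of parameter `t`, `-i γ'(t) / |γ'(t)|`;
for a positively oriented boundary this is the outward normal. -/
def normalAt (t : ℝ) : ℂ := -Complex.I * deriv C.γ t / (‖deriv C.γ t‖ : ℂ)

/-- The outward unit normal `ν(x)` at a point `x` of the curve. -/
def ν (x : ℂ) : ℂ := C.normalAt (Function.invFunOn C.γ C.I x)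

/-- The curve is a positively oriented, regular, simple parametrisation of the boundary of `D`, up
to finitely many points. -/
structure IsBoundaryOf (D : Set ℂ) : Prop where
  injOn : Set.InjOn C.γ C.I
  contDiff : ContDiff ℝ 1 C.γ
  deriv_ne_zero : ∀ t, deriv C.γ t ≠ 0
  image_subset : C.γ '' C.I ⊆ frontier D
  finite_diff : (frontier D \ C.γ '' C.I).Finite
  outward : ∀ t ∈ C.I, ∀ᶠ τ : ℝ in 𝓝[>] 0,
    C.γ t - τ * C.normalAt t ∈ D ∧ C.γ t + τ * C.normalAt t ∉ D

/-- The normal derivative `∂f/∂ν` at the point `x` of the curve. -/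
def dn {E : Type*} [NormedAddCommGroup E] [NormedSpace ℝ E] (f : ℂ → E) (x : ℂ) : E :=
  fderiv ℝ f x (C.ν x)

/-- The single layer potential `S[φ](x) = ∫ Γ(x, y) φ(y) dσ(y)`. -/
def S (φ : ℂ → ℂ) (x : ℂ) : ℂ := ∫ y, (fundSol x y : ℂ) * φ y ∂C.σ

/-- The kernel `∂Γ/∂ν(x) (x, y)` of the Neumann-Poincaré operator. -/
def npKernel (x y : ℂ) : ℝ := C.dn (fun z => fundSol z y) x

/-- The Neumann-Poincaré operator `K*[φ](x) = ∫ ∂Γ/∂ν(x) (x, y) φ(y) dσ(y)`. -/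
def Kstar (φ : ℂ → ℂ) (x : ℂ) : ℂ := ∫ y, (C.npKernel x y : ℂ) * φ y ∂C.σ

/-- The operator `l I - K*`. -/
def shift (l : ℂ) (φ : ℂ → ℂ) (x : ℂ) : ℂ := l * φ x - C.Kstar φ x

/-- `K*` is a well defined operator on `L²(∂D, dσ)` and `l I - K* : L²(∂D) → L²(∂D)` is bijective.
Elements of `L²` are represented by functions, identified when they agree almost everywhere. -/
structure ShiftInvertible (l : ℂ) : Prop where
  integrable : ∀ φ : ℂ → ℂ, MemLp φ 2 C.σ →
    ∀ᵐ x ∂C.σ, Integrable (fun y => (C.npKernel x y : ℂ) * φ y) C.σ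
  memLp : ∀ φ : ℂ → ℂ, MemLp φ 2 C.σ → MemLp (C.Kstar φ) 2 C.σ
  injective : ∀ φ ψ : ℂ → ℂ, MemLp φ 2 C.σ → MemLp ψ 2 C.σ →
    C.shift l φ =ᵐ[C.σ] C.shift l ψ → φ =ᵐ[C.σ] ψ
  surjective : ∀ g : ℂ → ℂ, MemLp g 2 C.σ →
    ∃ φ : ℂ → ℂ, MemLp φ 2 C.σ ∧ C.shift l φ =ᵐ[C.σ] g

open Classical in
/-- The inverse `(l I - K*)⁻¹` on `L²(∂D)`: a (representative of the) preimage of `g`. -/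
def shiftInv (l : ℂ) (g : ℂ → ℂ) : ℂ → ℂ :=
  if h : ∃ φ : ℂ → ℂ, MemLp φ 2 C.σ ∧ C.shift l φ =ᵐ[C.σ] g then h.choose else 0

end Curve

/-! ### The geometry -/

/-- The perturbed lower half-plane `ℍ_δ`, below the graph of `δ h₀`. -/
def halfPlane (h₀ : ℝ → ℝ) (δ : ℝ) : Set ℂ := {z | z.im < δ * h₀ z.re}

/-- The plasmonic particle `Ω`, the disk of radius `r` centred at `(0, d)`. -/
def particle (d r : ℝ) : Set ℂ := Metric.ball (d * Complex.I) r

/-- `√(d² - r²)`. -/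
def focus (d r : ℝ) : ℝ := Real.sqrt (d ^ 2 - r ^ 2)

/-- The Möbius map `Φ(z) = (z + i √(d² - r²)) / (z - i √(d² - r²))`. -/
def Phi (d r : ℝ) (z : ℂ) : ℂ :=
  (z + Complex.I * focus d r) / (z - Complex.I * focus d r)

/-- The inverse Möbius map `Φ⁻¹`. -/
def PhiInv (d r : ℝ) (w : ℂ) : ℂ := Complex.I * focus d r * (w + 1) / (w - 1)

/-- The parameter `s > 0` with `sinh s = √((d/r)² - 1)`. -/
def sPar (d r : ℝ) : ℝ := Real.arsinh (Real.sqrt ((d / r) ^ 2 - 1))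

/-- `D₁ = Φ(ℍ_δ)`. -/
def D₁ (d r : ℝ) (h₀ : ℝ → ℝ) (δ : ℝ) : Set ℂ := Phi d r '' halfPlane h₀ δ

/-- `D₂ = Φ(ℝ² \ closure Ω)`, which is the disk `|ζ| < e^s`.  As usual for a Möbius map the exterior
domain is taken with its point at infinity, whose image is `1`. -/
def D₂ (d r : ℝ) : Set ℂ := insert 1 (Phi d r '' (closure (particle d r))ᶜ)

/-- The boundary of `D₁`: the image under `Φ` of the graph of `δ h₀`, run from right to left so that
`D₁` lies on the left.  The point at infinity of the graph, sent to `ζ = 1`, is not parametrised. -/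
def bdry₁ (d r : ℝ) (h₀ : ℝ → ℝ) (δ : ℝ) : Curve where
  γ := fun t => Phi d r ((-t : ℝ) + (δ * h₀ (-t) : ℝ) * Complex.I)
  I := Set.univ

/-- The boundary of `D₂`, the circle `|ζ| = e^s`. -/
def bdry₂ (d r : ℝ) : Curve where
  γ := circleMap 0 (Real.exp (sPar d r))
  I := Set.Ioc (-Real.pi) Real.pi

/-! ### The fields and the operator `𝒜` -/

/-- The incident field `uⁱ(x) = -a · x`. -/
def uInc (a₁ a₂ : ℝ) (z : ℂ) : ℂ := ((-(a₁ * z.re + a₂ * z.im) : ℝ) : ℂ)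

/-- The transformed incident field `ũⁱ = uⁱ ∘ Φ⁻¹`. -/
def uIncT (d r a₁ a₂ : ℝ) (w : ℂ) : ℂ := uInc a₁ a₂ (PhiInv d r w)

/-- The contrast `(ε + ε') / (2 (ε - ε'))`. -/
def contrast (ε ε' : ℂ) : ℂ := (ε + ε') / (2 * (ε - ε'))

/-- `𝒜 = K*_{D₂} + ∂_{ν₂} S_{D₁} (l I - K*_{D₁})⁻¹ ∂_{ν₁} S_{D₂}` for boundaries `C₁`, `C₂`. -/
def opA (C₁ C₂ : Curve) (l : ℂ) (φ : ℂ → ℂ) (x : ℂ) : ℂ :=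
  C₂.Kstar φ x + C₂.dn (C₁.S (C₁.shiftInv l (C₁.dn (C₂.S φ)))) x

/-- The field `u + S_{D₁} (l I - K*_{D₁})⁻¹ [∂u/∂ν₁]`: the field `u` corrected by the response
of the domain `D₁` with boundary `C₁`. -/
def corrected (C₁ : Curve) (l : ℂ) (u : ℂ → ℂ) (x : ℂ) : ℂ :=
  u x + C₁.S (C₁.shiftInv l (C₁.dn u)) x

end

end Plasmon

/-!
# The reduced equation for the density on the boundary of the particle

The first equation of the system gives `φ₁ = (λ - K₁*)⁻¹ [∂ũ/∂ν₁] + (λ - K₁*)⁻¹ [∂S₂φ₂/∂ν₁]`, and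
inserting this in the second one gives the claim (`Plasmon.Curve.reduced_equation`).  The two
boundaries are disjoint compact sets, up to the point `1` of `∂D₁`, once `δ h₀` stays below the
particle (`Plasmon.disjoint_sphere_collar`), so every potential is smooth on the other boundary.
The field `ũ` is singular at `1 ∈ ∂D₁` and `∂ũ/∂ν₁` is not square integrable for every `a`; that it is
here follows from the first equation itself.

The substance is the invertibility of `λ - K₁*` on `L²(∂D₁)`, for all real `λ` with `|λ| > 1/2` at
once.  Pulled back by `Φ` to the graph of `δ h₀`, the Neumann-Poincaré kernel times the speed is
`k(t, s) + p(t)`, with `k` the kernel of the graph and `p` the contribution of the pole of `Φ`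
(`Plasmon.kernel_Phi_graphPt`).  Both are derivatives in `t` of angles, which gives
`∫ k(t, s) dt = 0` and `∫ p = 1/2` (`HolderBump.integral_graphKernel`, `HolderBump.integral_poleKernel`).  By Schur's
test the operator `A` with kernel `k` has norm `O(δ)` on `L²(∂D₁)`
(`HolderBump.exists_isSchurKernel`): near the diagonal because `h₀'` is Hölder continuous, far from
it because of the compact support, the speed being comparable to `1 / (1 + t²)`.  Integrating
`(λ - K₁*) f = h` determines `∫ f = ∫ h / (λ - 1/2)`, and with this value the equation becomes one
for `λ - A`, where `‖A‖ < 1/2 < |λ|` (`IsSchurKernel.exists_eq_add`, `IsSchurKernel.eq_zero_add`).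
-/

open scoped ENNReal NNReal

/-! ### Schur's test and rank one perturbations -/

/-- The Cauchy-Schwarz inequality for the measure `b dμ`. -/
theorem sq_lintegral_mul_le {α : Type*} [MeasurableSpace α] {μ : Measure α} {b f : α → ℝ≥0∞}
    (hb : AEMeasurable b μ) (hf : AEMeasurable f μ) :
    (∫⁻ s, b s * f s ∂μ) ^ 2 ≤ (∫⁻ s, b s ∂μ) * ∫⁻ s, b s * f s ^ 2 ∂μ := by
  have hsqrt : ∀ x : ℝ≥0∞, x ^ (1 / 2 : ℝ) * x ^ (1 / 2 : ℝ) = x := fun x ↦ by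
    rw [← ENNReal.rpow_add_of_nonneg _ _ (by norm_num) (by norm_num), add_halves, ENNReal.rpow_one]
  have h := ENNReal.lintegral_mul_le_Lp_mul_Lq μ Real.HolderConjugate.two_two
    (hb.pow_const (1 / 2 : ℝ)) ((hb.pow_const (1 / 2 : ℝ)).mul hf)
  simp only [Pi.mul_apply, ← mul_assoc, hsqrt, ENNReal.rpow_two, mul_pow, pow_two (_ ^ (1 / 2 : ℝ))]
    at h
  calc (∫⁻ s, b s * f s ∂μ) ^ 2 ≤ _ := pow_le_pow_left' h 2
    _ = _ := by rw [mul_pow, sq, hsqrt, sq, hsqrt]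

/-- Schur's test on `L²`, for a nonnegative kernel whose rows and columns have integral at most
`C`. -/
theorem lintegral_sq_lintegral_mul_le {α : Type*} [MeasurableSpace α] {μ : Measure α} [SFinite μ]
    {b : α → α → ℝ≥0∞} (hb : Measurable (Function.uncurry b)) {C : ℝ≥0∞}
    (hrow : ∀ t, ∫⁻ s, b t s ∂μ ≤ C) (hcol : ∀ s, ∫⁻ t, b t s ∂μ ≤ C)
    {f : α → ℝ≥0∞} (hf : AEMeasurable f μ) :
    ∫⁻ t, (∫⁻ s, b t s * f s ∂μ) ^ 2 ∂μ ≤ C ^ 2 * ∫⁻ s, f s ^ 2 ∂μ := by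
  have hb1 : ∀ t, Measurable (b t) := fun t ↦ hb.comp measurable_prodMk_left
  have hb2 : ∀ s, Measurable fun t ↦ b t s := fun t ↦ hb.comp measurable_prodMk_right
  calc ∫⁻ t, (∫⁻ s, b t s * f s ∂μ) ^ 2 ∂μ
      ≤ ∫⁻ t, C * ∫⁻ s, b t s * f s ^ 2 ∂μ ∂μ := lintegral_mono fun t ↦
        (sq_lintegral_mul_le (hb1 t).aemeasurable hf).trans (mul_le_mul_left (hrow t) _)
    _ = C * ∫⁻ t, ∫⁻ s, b t s * f s ^ 2 ∂μ ∂μ := by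
        refine lintegral_const_mul'' _ ?_
        exact (hb.aemeasurable.mul ((hf.pow_const 2).comp_quasiMeasurePreserving
          Measure.quasiMeasurePreserving_snd)).lintegral_prod_right'
    _ = C * ∫⁻ s, ∫⁻ t, b t s * f s ^ 2 ∂μ ∂μ := by
        rw [lintegral_lintegral_swap]
        exact hb.aemeasurable.mul ((hf.pow_const 2).comp_quasiMeasurePreserving
          Measure.quasiMeasurePreserving_snd)
    _ ≤ C * ∫⁻ s, C * f s ^ 2 ∂μ := by
        gcongr with s
        rw [lintegral_mul_const _ (hb2 s)]
        gcongr
        exact hcol s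
    _ = C ^ 2 * ∫⁻ s, f s ^ 2 ∂μ := by
        rw [lintegral_const_mul'' _ (hf.pow_const 2), sq, mul_assoc]

theorem eLpNorm_two_sq {α E : Type*} [MeasurableSpace α] [NormedAddCommGroup E] (μ : Measure α)
    (f : α → E) : eLpNorm f 2 μ ^ 2 = ∫⁻ t, ‖f t‖ₑ ^ 2 ∂μ := by
  rw [eLpNorm_eq_lintegral_rpow_enorm_toReal (by norm_num) (by norm_num), ← ENNReal.rpow_natCast,
    ← ENNReal.rpow_mul]
  simp

theorem enorm_ofReal (x : ℝ) : ‖(x : ℂ)‖ₑ = ‖x‖ₑ := by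
  simp [← ofReal_norm]

/-- The integral operator `f ↦ ∫ a(·, s) f(s) dμ(s)` with the real kernel `a`, on complex
functions. -/
noncomputable def kernelOp {α : Type*} [MeasurableSpace α] (μ : Measure α) (a : α → α → ℝ)
    (f : α → ℂ) (t : α) : ℂ := ∫ s, (a t s : ℂ) * f s ∂μ

/-- The kernel `a` satisfies the hypotheses of Schur's test with the constant `C`: its rows and its
columns have `L¹` norm at most `C`. -/
structure IsSchurKernel {α : Type*} [MeasurableSpace α] (μ : Measure α) (a : α → α → ℝ)
    (C : ℝ≥0) : Prop where
  measurable : Measurable (Function.uncurry a)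
  row_le : ∀ t, ∫⁻ s, ‖a t s‖ₑ ∂μ ≤ C
  col_le : ∀ s, ∫⁻ t, ‖a t s‖ₑ ∂μ ≤ C

namespace IsSchurKernel

variable {α : Type*} [MeasurableSpace α] {μ : Measure α} {a : α → α → ℝ} {C : ℝ≥0}

/-- Schur's test for the integral of the modulus, from which both the convergence of the integral
defining `kernelOp` and the bound on its norm follow. -/
theorem lintegral_sq_le [SFinite μ] (ha : IsSchurKernel μ a C) {f : α → ℂ} (hf : MemLp f 2 μ) :
    ∫⁻ t, (∫⁻ s, ‖(a t s : ℂ) * f s‖ₑ ∂μ) ^ 2 ∂μ ≤ (C * eLpNorm f 2 μ) ^ 2 := by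
  have h := lintegral_sq_lintegral_mul_le (μ := μ) (b := fun t s ↦ ‖a t s‖ₑ)
    ha.measurable.enorm ha.row_le ha.col_le hf.1.enorm
  rw [mul_pow, eLpNorm_two_sq]
  simpa only [enorm_mul, enorm_ofReal] using h

theorem aestronglyMeasurable [SFinite μ] (ha : IsSchurKernel μ a C) {f : α → ℂ}
    (hf : AEStronglyMeasurable f μ) :
    AEStronglyMeasurable (fun p : α × α ↦ (a p.1 p.2 : ℂ) * f p.2) (μ.prod μ) :=
  (Complex.measurable_ofReal.comp ha.measurable).aestronglyMeasurable.mul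
    (hf.comp_quasiMeasurePreserving Measure.quasiMeasurePreserving_snd)

theorem ae_integrable [SFinite μ] (ha : IsSchurKernel μ a C) {f : α → ℂ} (hf : MemLp f 2 μ) :
    ∀ᵐ t ∂μ, Integrable (fun s ↦ (a t s : ℂ) * f s) μ := by
  have hm := ha.aestronglyMeasurable hf.1
  have hfin := ae_lt_top' (hm.enorm.lintegral_prod_right'.pow_const 2)
    ((ha.lintegral_sq_le hf).trans_lt
      (ENNReal.pow_lt_top (ENNReal.mul_lt_top ENNReal.coe_lt_top hf.2))).ne
  filter_upwards [hfin, hm.prodMk_left] with t ht hmt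
  exact ⟨hmt, by simpa [HasFiniteIntegral] using ht⟩

theorem eLpNorm_kernelOp_le [SFinite μ] (ha : IsSchurKernel μ a C) {f : α → ℂ}
    (hf : MemLp f 2 μ) : eLpNorm (kernelOp μ a f) 2 μ ≤ C * eLpNorm f 2 μ := by
  rw [← ENNReal.pow_le_pow_left_iff two_ne_zero, eLpNorm_two_sq]
  refine (lintegral_mono fun t ↦ ?_).trans (ha.lintegral_sq_le hf)
  exact pow_le_pow_left' (enorm_integral_le_lintegral_enorm _) 2

theorem memLp_kernelOp [SFinite μ] (ha : IsSchurKernel μ a C) {f : α → ℂ}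
    (hf : MemLp f 2 μ) : MemLp (kernelOp μ a f) 2 μ :=
  ⟨(ha.aestronglyMeasurable hf.1).integral_prod_right', (ha.eLpNorm_kernelOp_le hf).trans_lt
    (ENNReal.mul_lt_top ENNReal.coe_lt_top hf.2)⟩

theorem kernelOp_sub [SFinite μ] (ha : IsSchurKernel μ a C) {f g : α → ℂ}
    (hf : MemLp f 2 μ) (hg : MemLp g 2 μ) :
    kernelOp μ a (f - g) =ᵐ[μ] kernelOp μ a f - kernelOp μ a g := by
  filter_upwards [ha.ae_integrable hf, ha.ae_integrable hg] with t h1 h2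
  simp only [kernelOp, Pi.sub_apply, mul_sub]
  exact integral_sub h1 h2

theorem integral_kernelOp_eq_zero [IsFiniteMeasure μ] (ha : IsSchurKernel μ a C)
    (h0 : ∀ s, ∫ t, a t s ∂μ = 0) {f : α → ℂ} (hf : MemLp f 2 μ) :
    ∫ t, kernelOp μ a f t ∂μ = 0 := by
  have hm := ha.aestronglyMeasurable hf.1
  have hint : Integrable (fun p : α × α ↦ (a p.1 p.2 : ℂ) * f p.2) (μ.prod μ) := by
    refine ⟨hm, ?_⟩
    rw [HasFiniteIntegral, lintegral_prod_symm _ hm.enorm]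
    have hf1 : Integrable f μ := hf.integrable (by norm_num)
    calc ∫⁻ s, ∫⁻ t, ‖(a t s : ℂ) * f s‖ₑ ∂μ ∂μ ≤ ∫⁻ s, C * ‖f s‖ₑ ∂μ := by
          refine lintegral_mono fun s ↦ ?_
          simp only [enorm_mul, enorm_ofReal]
          have : Measurable fun t ↦ ‖a t s‖ₑ :=
            (ha.measurable.comp measurable_prodMk_right).enorm
          rw [lintegral_mul_const _ this]
          exact mul_le_mul_left (ha.col_le s) _
      _ = C * ∫⁻ s, ‖f s‖ₑ ∂μ := lintegral_const_mul'' _ hf.1.enorm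
      _ < ∞ := ENNReal.mul_lt_top ENNReal.coe_lt_top hf1.2
  unfold kernelOp
  rw [integral_integral_swap hint]
  have : ∀ s, ∫ t, (a t s : ℂ) * f s ∂μ = 0 := fun s ↦ by
    rw [integral_mul_const, integral_complex_ofReal, h0]; simp
  simp [this]

/-- `l - A` is onto when `‖A‖ ≤ C < |l|`: the solution is the fixed point of the contraction
`f ↦ l⁻¹ (A f + h)` of `L²`. -/
theorem exists_eq [SFinite μ] (ha : IsSchurKernel μ a C) {l : ℂ} (hl : C < ‖l‖) {h : α → ℂ}
    (hh : MemLp h 2 μ) :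
    ∃ f : α → ℂ, MemLp f 2 μ ∧ ∀ᵐ t ∂μ, l * f t - kernelOp μ a f t = h t := by
  have hl0 : 0 < ‖l‖ := C.2.trans_lt hl
  have hl1 : l ≠ 0 := norm_pos_iff.1 hl0
  have hT : ∀ f : Lp ℂ 2 μ, MemLp (l⁻¹ • (kernelOp μ a f + h)) 2 μ := fun f ↦
    ((ha.memLp_kernelOp (Lp.memLp f)).add hh).const_smul _
  have hcon : ContractingWith (C / ‖l‖₊) fun f : Lp ℂ 2 μ ↦ (hT f).toLp := by
    refine ⟨by rw [div_lt_one (by exact_mod_cast hl0)]; exact_mod_cast hl, fun f g ↦ ?_⟩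
    have hae : l⁻¹ • (kernelOp μ a f + h) - l⁻¹ • (kernelOp μ a g + h) =ᵐ[μ]
        l⁻¹ • kernelOp μ a (f - g : Lp ℂ 2 μ) := by
      have hfg : kernelOp μ a (f - g : Lp ℂ 2 μ) = kernelOp μ a (⇑f - ⇑g) := by
        ext t
        refine integral_congr_ae ?_
        filter_upwards [Lp.coeFn_sub f g] with s hs
        rw [hs]
      filter_upwards [ha.kernelOp_sub (Lp.memLp f) (Lp.memLp g)] with t ht
      simp only [Pi.sub_apply, Pi.smul_apply, Pi.add_apply, hfg, ht, smul_eq_mul]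
      ring
    rw [Lp.edist_toLp_toLp, eLpNorm_congr_ae hae, eLpNorm_const_smul, Lp.edist_def,
      ← eLpNorm_congr_ae (Lp.coeFn_sub f g), enorm_inv hl1, ENNReal.coe_div (by simpa using hl1),
      ENNReal.div_eq_inv_mul, mul_assoc]
    exact mul_le_mul_right (ha.eLpNorm_kernelOp_le (Lp.memLp _)) _
  set F : Lp ℂ 2 μ := ContractingWith.fixedPoint _ hcon
  have hfix : (hT F).toLp = F := hcon.fixedPoint_isFixedPt
  refine ⟨F, Lp.memLp _, ?_⟩
  have h2 := (hT F).coeFn_toLp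
  rw [hfix] at h2
  filter_upwards [h2] with t ht
  rw [ht]
  simp only [Pi.smul_apply, Pi.add_apply, smul_eq_mul]
  field_simp
  ring

theorem eq_zero [SFinite μ] (ha : IsSchurKernel μ a C) {l : ℂ} (hl : C < ‖l‖) {f : α → ℂ}
    (hf : MemLp f 2 μ) (h : ∀ᵐ t ∂μ, l * f t = kernelOp μ a f t) : f =ᵐ[μ] 0 := by
  have h1 : eLpNorm (l • f) 2 μ ≤ C * eLpNorm f 2 μ := by
    rw [eLpNorm_congr_ae (show l • f =ᵐ[μ] kernelOp μ a f from h)]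
    exact ha.eLpNorm_kernelOp_le hf
  rw [eLpNorm_const_smul] at h1
  rw [← eLpNorm_eq_zero_iff hf.1 (two_ne_zero)]
  by_contra h0
  have := (ENNReal.mul_le_mul_iff_left h0 hf.2.ne).1 h1
  rw [enorm_le_coe] at this
  exact absurd hl (not_lt.2 (by exact_mod_cast this))

variable {q : α → ℝ}

theorem kernelOp_add (hμ : IsFiniteMeasure μ) (ha : IsSchurKernel μ a C) {f : α → ℂ}
    (hf : MemLp f 2 μ) : ∀ᵐ t ∂μ,
      Integrable (fun s ↦ ((a t s + q t : ℝ) : ℂ) * f s) μ ∧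
      kernelOp μ (fun t s ↦ a t s + q t) f t = kernelOp μ a f t + q t * ∫ s, f s ∂μ := by
  have hf1 : Integrable f μ := hf.integrable (by norm_num)
  filter_upwards [ha.ae_integrable hf] with t ht
  simp only [kernelOp, Complex.ofReal_add, add_mul]
  exact ⟨ht.add (hf1.const_mul _), by
    rw [integral_add ht (hf1.const_mul _), integral_const_mul]⟩

/-- The operator with kernel `a(t, s) + q(t)`, a rank one perturbation of the operator `A` with
kernel `a`.  As the columns of `a` have mean zero and `∫ q = 1/2`, integrating the equation gives
`∫ f = ∫ h / (l - 1/2)`, and what remains is an equation for `l - A`. -/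
theorem exists_eq_add [IsFiniteMeasure μ] (ha : IsSchurKernel μ a C)
    (h0 : ∀ s, ∫ t, a t s ∂μ = 0) (hq : MemLp q 2 μ) (hq1 : ∫ t, q t ∂μ = 1 / 2) {l : ℂ}
    (hl : C < ‖l‖) (hl2 : l ≠ 1 / 2) {h : α → ℂ} (hh : MemLp h 2 μ) :
    ∃ f : α → ℂ, MemLp f 2 μ ∧
      ∀ᵐ t ∂μ, l * f t - kernelOp μ (fun t s ↦ a t s + q t) f t = h t := by
  have hl1 : l ≠ 0 := norm_pos_iff.1 (C.2.trans_lt hl)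
  have hl3 : l - 1 / 2 ≠ 0 := sub_ne_zero.2 hl2
  have hqc : MemLp (fun t ↦ (q t : ℂ)) 2 μ := hq.ofReal
  set m : ℂ := (∫ t, h t ∂μ) / (l - 1 / 2) with hm
  obtain ⟨f, hf, hfe⟩ := ha.exists_eq hl (hh.add (hqc.mul_const m))
  have hf1 : Integrable f μ := hf.integrable (by norm_num)
  have hfm : ∫ t, f t ∂μ = m := by
    have h1 : ∫ t, (l * f t - kernelOp μ a f t) ∂μ = ∫ t, (h t + q t * m) ∂μ :=
      integral_congr_ae hfe
    rw [integral_sub (hf1.const_mul _) ((ha.memLp_kernelOp hf).integrable (by norm_num)),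
      ha.integral_kernelOp_eq_zero h0 hf, integral_const_mul,
      integral_add (hh.integrable (by norm_num)) ((hqc.mul_const m).integrable (by norm_num)),
      integral_mul_const, integral_complex_ofReal, hq1] at h1
    have h2 : ∫ t, h t ∂μ = m * (l - 1 / 2) := by rw [hm, div_mul_cancel₀ _ hl3]
    rw [h2] at h1
    have h3 : l * ∫ t, f t ∂μ = l * m := by
      rw [sub_zero] at h1; rw [h1]; push_cast; ring
    exact mul_left_cancel₀ hl1 h3
  -- the prescribed value `m` of the integral is attained, so `f` solves the perturbed equation
  refine ⟨f, hf, ?_⟩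
  filter_upwards [hfe, ha.kernelOp_add (q := q) inferInstance hf] with t h1 h2
  rw [h2.2, hfm]
  simp only [Pi.add_apply] at h1
  linear_combination h1

theorem eq_zero_add [IsFiniteMeasure μ] (ha : IsSchurKernel μ a C)
    (h0 : ∀ s, ∫ t, a t s ∂μ = 0) (hq : MemLp q 2 μ) (hq1 : ∫ t, q t ∂μ = 1 / 2) {l : ℂ}
    (hl : C < ‖l‖) (hl2 : l ≠ 1 / 2) {f : α → ℂ} (hf : MemLp f 2 μ)
    (h : ∀ᵐ t ∂μ, l * f t = kernelOp μ (fun t s ↦ a t s + q t) f t) : f =ᵐ[μ] 0 := by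
  have hqc : MemLp (fun t ↦ (q t : ℂ)) 2 μ := hq.ofReal
  have h' : ∀ᵐ t ∂μ, l * f t = kernelOp μ a f t + q t * ∫ s, f s ∂μ := by
    filter_upwards [h, ha.kernelOp_add (q := q) inferInstance hf] with t h1 h2
    rw [h1, h2.2]
  have hfm : ∫ t, f t ∂μ = 0 := by
    have h1 := integral_congr_ae h'
    rw [integral_add ((ha.memLp_kernelOp hf).integrable (by norm_num))
      ((hqc.mul_const _).integrable (by norm_num)), ha.integral_kernelOp_eq_zero h0 hf,
      integral_const_mul, integral_mul_const, integral_complex_ofReal, hq1] at h1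
    have h3 : (l - 1 / 2) * ∫ t, f t ∂μ = 0 := by
      push_cast at h1; linear_combination h1
    exact (mul_eq_zero.1 h3).resolve_left (sub_ne_zero.2 hl2)
  refine ha.eq_zero hl hf ?_
  filter_upwards [h'] with t ht
  rw [ht, hfm]; simp

end IsSchurKernel

/-! ### The kernel of a graph -/

/-- `k` is a `C^{1,η}` function supported in `[-R, R]`, with `|k|, |k'| ≤ M`; the Hölder condition
on `k'` enters through the remainder of the first order Taylor expansion. -/
structure HolderBump (k : ℝ → ℝ) (R M K η : ℝ) : Prop where
  contDiff : ContDiff ℝ 1 k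
  radius_pos : 0 < R
  exponent_pos : 0 < η
  abs_le : ∀ t, |k t| ≤ M
  abs_deriv_le : ∀ t, |deriv k t| ≤ M
  eq_zero : ∀ t, R < |t| → k t = 0
  taylor : ∀ t s, |k t - k s - deriv k t * (t - s)| ≤ K * |t - s| ^ (η + 1)

/-- The Taylor remainder of `k` at `t`, divided by the square of the increment.  It bounds
`graphKernel k t s`. -/
noncomputable def taylorQuot (k : ℝ → ℝ) (t s : ℝ) : ℝ :=
  |k t - k s - deriv k t * (t - s)| / (t - s) ^ 2

/-- An integrable majorant of `taylorQuot` near the diagonal. -/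
noncomputable def nearMaj (K η : ℝ) (x : ℝ) : ℝ :=
  (Set.Icc (-1) 1).indicator (fun x ↦ K * |x| ^ (η - 1)) x

theorem nearMaj_of_le {K η x : ℝ} (hx : |x| ≤ 1) : nearMaj K η x = K * |x| ^ (η - 1) :=
  Set.indicator_of_mem (show x ∈ Set.Icc (-1) 1 from abs_le.1 hx) _

theorem nearMaj_nonneg {K η x : ℝ} (hK : 0 ≤ K) : 0 ≤ nearMaj K η x :=
  Set.indicator_nonneg (fun _ _ ↦ by positivity) _

theorem integrable_nearMaj {K η : ℝ} (hη : 0 < η) : Integrable (nearMaj K η) := by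
  have h0 : IntervalIntegrable (fun x : ℝ ↦ |x| ^ (η - 1)) volume 0 1 := by
    refine (intervalIntegral.intervalIntegrable_rpow' (by linarith : -1 < η - 1)).congr ?_
    intro x hx
    rw [Set.uIoc_of_le zero_le_one] at hx
    simp only [abs_of_pos hx.1]
  have h1 : IntervalIntegrable (fun x : ℝ ↦ |x| ^ (η - 1)) volume (-1) 0 := by
    rw [IntervalIntegrable.iff_comp_neg]
    simpa using h0.symm
  have h2 := h1.trans h0
  rw [intervalIntegrable_iff_integrableOn_Icc_of_le (by norm_num)] at h2
  exact IntegrableOn.integrable_indicator (h2.const_mul K) measurableSet_Icc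

namespace HolderBump

variable {k : ℝ → ℝ} {R M K η : ℝ}

theorem bound_nonneg (hk : HolderBump k R M K η) : 0 ≤ M := (abs_nonneg _).trans (hk.abs_le 0)

theorem const_nonneg (hk : HolderBump k R M K η) : 0 ≤ K := by
  simpa using (abs_nonneg _).trans (hk.taylor 1 0)

theorem differentiable (hk : HolderBump k R M K η) : Differentiable ℝ k :=
  hk.contDiff.differentiable (by norm_num)

theorem deriv_eq_zero (hk : HolderBump k R M K η) {t : ℝ} (ht : R < |t|) : deriv k t = 0 := by
  have : k =ᶠ[𝓝 t] fun _ ↦ 0 := by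
    filter_upwards [(isOpen_lt continuous_const continuous_abs).mem_nhds ht] with s hs
    exact hk.eq_zero s hs
  rw [this.deriv_eq, deriv_const]

theorem taylorQuot_near (hk : HolderBump k R M K η) {t s : ℝ} (h : |t - s| ≤ 1) :
    taylorQuot k t s ≤ nearMaj K η (t - s) := by
  rw [nearMaj_of_le h]
  rcases eq_or_ne t s with rfl | hts
  · have := hk.const_nonneg
    simp only [taylorQuot, sub_self]
    simp only [ne_eq, OfNat.ofNat_ne_zero, not_false_eq_true, zero_pow, div_zero]
    positivity
  · have hpos : 0 < |t - s| := abs_pos.2 (sub_ne_zero.2 hts)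
    rw [taylorQuot, div_le_iff₀ (by rw [← sq_abs]; positivity), mul_assoc, ← sq_abs (t - s),
      ← Real.rpow_natCast, ← Real.rpow_add hpos]
    refine (hk.taylor t s).trans_eq ?_
    congr 2
    push_cast
    ring

theorem taylorQuot_far_in (hk : HolderBump k R M K η) {t s : ℝ} (h : 1 < |t - s|) :
    taylorQuot k t s ≤ 3 * M := by
  have hM := hk.bound_nonneg
  rw [taylorQuot, div_le_iff₀ (by rw [← sq_abs]; positivity), ← sq_abs]
  have h1 : |k t - k s - deriv k t * (t - s)| ≤ M + M + M * |t - s| := by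
    refine (abs_sub _ _).trans (add_le_add ((abs_sub _ _).trans
      (add_le_add (hk.abs_le t) (hk.abs_le s))) ?_)
    rw [abs_mul]
    exact mul_le_mul_of_nonneg_right (hk.abs_deriv_le t) (abs_nonneg _)
  nlinarith [mul_nonneg hM (sub_nonneg.2 h.le), mul_nonneg hM (sq_nonneg (|t - s| - 1))]

theorem taylorQuot_far_out (hk : HolderBump k R M K η) {t s : ℝ} (ht : R < |t|) :
    taylorQuot k t s ≤ M / (t - s) ^ 2 := by
  rw [taylorQuot, hk.eq_zero t ht, hk.deriv_eq_zero ht]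
  gcongr
  simpa using hk.abs_le s

theorem taylorQuot_out_out (hk : HolderBump k R M K η) {t s : ℝ} (ht : R < |t|) (hs : R < |s|) :
    taylorQuot k t s = 0 := by
  rw [taylorQuot, hk.eq_zero t ht, hk.deriv_eq_zero ht, hk.eq_zero s hs]
  simp

/-- A majorant of `taylorQuot k t (t - x)` whose integral in `t` along `x = t - s` does not depend
on `s`. -/
noncomputable def colMaj (R M K η t x : ℝ) : ℝ :=
  nearMaj K η x + (Set.Icc (-R) R).indicator (fun _ ↦ 3 * M) t + 2 * M * (1 + x ^ 2)⁻¹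

/-- A majorant of `taylorQuot k (s + x) s`, weighted by `(1 + (s + x)²) / (1 + s²)`, whose integral
in `s` along `x = t - s` does not depend on `t`. -/
noncomputable def rowMaj (R M K η s x : ℝ) : ℝ :=
  4 * nearMaj K η x + (Set.Icc (-R) R).indicator (fun _ ↦ 4 * M) s +
    3 * M * (1 + R ^ 2) * (1 + s ^ 2)⁻¹

theorem indicator_Icc_nonneg {R M x : ℝ} (hM : 0 ≤ M) :
    0 ≤ (Set.Icc (-R) R).indicator (fun _ ↦ M) x :=
  Set.indicator_nonneg (fun _ _ ↦ hM) _

theorem taylorQuot_le_col (hk : HolderBump k R M K η) (t s : ℝ) :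
    taylorQuot k t s ≤ colMaj R M K η t (t - s) := by
  have hM := hk.bound_nonneg
  have h1 : 0 ≤ nearMaj K η (t - s) := nearMaj_nonneg hk.const_nonneg
  have h2 : 0 ≤ (Set.Icc (-R) R).indicator (fun _ ↦ 3 * M) t := indicator_Icc_nonneg (by positivity)
  have h3 : 0 ≤ 2 * M * (1 + (t - s) ^ 2)⁻¹ := by positivity
  rw [colMaj]
  rcases le_or_gt |t - s| 1 with h | h
  · linarith [hk.taylorQuot_near h]
  rcases le_or_gt |t| R with ht | ht
  · rw [Set.indicator_of_mem (show t ∈ Set.Icc (-R) R from _root_.abs_le.1 ht)]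
    linarith [hk.taylorQuot_far_in h]
  · have h4 : M / (t - s) ^ 2 ≤ 2 * M * (1 + (t - s) ^ 2)⁻¹ := by
      have : 1 < (t - s) ^ 2 := by rw [← sq_abs]; nlinarith
      rw [← div_eq_mul_inv, div_le_div_iff₀ (by positivity) (by positivity)]
      nlinarith
    linarith [hk.taylorQuot_far_out (s := s) ht]

theorem taylorQuot_mul_le_row (hk : HolderBump k R M K η) (t s : ℝ) :
    taylorQuot k t s * ((1 + t ^ 2) / (1 + s ^ 2)) ≤ rowMaj R M K η s (t - s) := by
  have hM := hk.bound_nonneg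
  have h0 : 0 ≤ taylorQuot k t s := by unfold taylorQuot; positivity
  have h1 : 0 ≤ nearMaj K η (t - s) := nearMaj_nonneg hk.const_nonneg
  have h2 : 0 ≤ (Set.Icc (-R) R).indicator (fun _ ↦ 4 * M) s := indicator_Icc_nonneg (by positivity)
  have h3 : 0 ≤ 3 * M * (1 + R ^ 2) * (1 + s ^ 2)⁻¹ := by positivity
  -- Peetre's inequality
  have hp : (1 + t ^ 2) / (1 + s ^ 2) ≤ 2 * (1 + (t - s) ^ 2) := by
    rw [div_le_iff₀ (by positivity)]
    nlinarith [sq_nonneg (t - 2 * s), mul_nonneg (sq_nonneg s) (sq_nonneg (t - s))]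
  rw [rowMaj]
  rcases le_or_gt |t - s| 1 with h | h
  · have : (t - s) ^ 2 ≤ 1 := by rw [← sq_abs]; nlinarith [abs_nonneg (t - s)]
    have := mul_le_mul (hk.taylorQuot_near h) (hp.trans (by linarith : _ ≤ (4 : ℝ)))
      (by positivity) h1
    linarith
  have h5 : 1 < (t - s) ^ 2 := by rw [← sq_abs]; nlinarith
  rcases le_or_gt |t| R with ht | ht
  · have h4 : 1 + t ^ 2 ≤ 1 + R ^ 2 := by
      rw [← sq_abs t]; gcongr
    have := mul_le_mul (hk.taylorQuot_far_in h)
      (by gcongr : (1 + t ^ 2) / (1 + s ^ 2) ≤ (1 + R ^ 2) / (1 + s ^ 2)) (by positivity)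
      (by positivity)
    rw [div_eq_mul_inv (1 + R ^ 2), ← mul_assoc] at this
    linarith
  rcases le_or_gt |s| R with hs | hs
  · rw [Set.indicator_of_mem (show s ∈ Set.Icc (-R) R from _root_.abs_le.1 hs)]
    have h6 : M / (t - s) ^ 2 * (2 * (1 + (t - s) ^ 2)) ≤ 4 * M := by
      rw [div_mul_eq_mul_div, div_le_iff₀ (by positivity)]
      nlinarith
    linarith [mul_le_mul (hk.taylorQuot_far_out (s := s) ht) hp (by positivity) (by positivity)]
  · rw [hk.taylorQuot_out_out ht hs, zero_mul]
    positivity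

theorem integrable_indicator_const (R M : ℝ) :
    Integrable ((Set.Icc (-R) R).indicator fun _ ↦ M) :=
  (integrableOn_const (by simp)).integrable_indicator measurableSet_Icc

theorem integral_colMaj (hη : 0 < η) (s : ℝ) :
    Integrable (fun t ↦ colMaj R M K η t (t - s)) ∧
      ∫ t, colMaj R M K η t (t - s) = ∫ t, colMaj R M K η t t := by
  have h1 := (integrable_nearMaj (K := K) hη)
  have h2 := integrable_indicator_const R (3 * M)
  have h3 := integrable_inv_one_add_sq.const_mul (2 * M)
  have h12 : Integrable fun t ↦ nearMaj K η (t - s) +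
      (Set.Icc (-R) R).indicator (fun _ ↦ 3 * M) t := (h1.comp_sub_right s).add h2
  have h12' : Integrable fun t ↦ nearMaj K η t +
      (Set.Icc (-R) R).indicator (fun _ ↦ 3 * M) t := h1.add h2
  simp only [colMaj]
  refine ⟨h12.add (h3.comp_sub_right s), ?_⟩
  rw [integral_add h12 (h3.comp_sub_right s), integral_add (h1.comp_sub_right s) h2,
    integral_add h12' h3, integral_add h1 h2,
    integral_sub_right_eq_self (nearMaj K η) s,
    integral_sub_right_eq_self (fun t ↦ 2 * M * (1 + t ^ 2)⁻¹) s]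

theorem integral_rowMaj (hη : 0 < η) (t : ℝ) :
    Integrable (fun s ↦ rowMaj R M K η s (t - s)) ∧
      ∫ s, rowMaj R M K η s (t - s) = ∫ s, rowMaj R M K η s s := by
  have h1 := (integrable_nearMaj (K := K) hη).const_mul 4
  have h2 := integrable_indicator_const R (4 * M)
  have h3 := integrable_inv_one_add_sq.const_mul (3 * M * (1 + R ^ 2))
  have h12 : Integrable fun s ↦ 4 * nearMaj K η (t - s) +
      (Set.Icc (-R) R).indicator (fun _ ↦ 4 * M) s := (h1.comp_sub_left t).add h2
  have h12' : Integrable fun s ↦ 4 * nearMaj K η s +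
      (Set.Icc (-R) R).indicator (fun _ ↦ 4 * M) s := h1.add h2
  simp only [rowMaj]
  refine ⟨h12.add h3, ?_⟩
  rw [integral_add h12 h3, integral_add (h1.comp_sub_left t) h2,
    integral_add h12' h3, integral_add h1 h2,
    integral_sub_left_eq_self (fun s ↦ 4 * nearMaj K η s) volume t]

end HolderBump

/-- `(1/2π) Re (n(t) / (z(t) - z(s)))` for the graph `z(t) = -t + i g(t)` with the (not normalised)
normal `n(t) = -i z'(t)`: the Neumann-Poincaré kernel of the graph. -/
noncomputable def graphKernel (g : ℝ → ℝ) (t s : ℝ) : ℝ :=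
  1 / (2 * Real.pi) * ((g t - g s - deriv g t * (t - s)) / ((t - s) ^ 2 + (g t - g s) ^ 2))

/-- `-(1/2π) Re (n(t) / (z(t) - ic))` for the same graph: the contribution of the pole `ic` of the
Möbius map, which does not depend on `s`. -/
noncomputable def poleKernel (g : ℝ → ℝ) (c t : ℝ) : ℝ :=
  1 / (2 * Real.pi) * ((deriv g t * t + (c - g t)) / (t ^ 2 + (c - g t) ^ 2))

theorem abs_graphKernel_le (k : ℝ → ℝ) {δ : ℝ} (hδ : 0 ≤ δ) (t s : ℝ) :
    |graphKernel (fun u ↦ δ * k u) t s| ≤ δ * taylorQuot k t s := by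
  rcases eq_or_ne t s with rfl | hts
  · simp [graphKernel, taylorQuot]
  have hpos : 0 < (t - s) ^ 2 := by have := sub_ne_zero.2 hts; positivity
  have hpi : (1 : ℝ) / (2 * Real.pi) ≤ 1 := by
    rw [div_le_one (by positivity)]; linarith [Real.pi_gt_three]
  have hD : 0 < (t - s) ^ 2 + (δ * k t - δ * k s) ^ 2 := by positivity
  have : δ * k t - δ * k s - δ * deriv k t * (t - s) = δ * (k t - k s - deriv k t * (t - s)) := by
    ring
  rw [graphKernel, deriv_const_mul_field', this, abs_mul,
    abs_of_pos (by positivity : (0 : ℝ) < 1 / (2 * Real.pi)), taylorQuot, abs_div, abs_of_pos hD,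
    abs_mul, abs_of_nonneg hδ, mul_div_assoc]
  calc _ ≤ 1 * (δ * (|k t - k s - deriv k t * (t - s)| / (t - s) ^ 2)) := by
        gcongr
        nlinarith [sq_nonneg (δ * k t - δ * k s)]
    _ = _ := one_mul _

theorem measurable_graphKernel {g : ℝ → ℝ} (hg : ContDiff ℝ 1 g) :
    Measurable (Function.uncurry (graphKernel g)) := by
  have h1 : Measurable g := hg.continuous.measurable
  have h2 : Measurable (deriv g) := hg.continuous_deriv_one.measurable
  unfold graphKernel Function.uncurry
  fun_prop

theorem measurable_poleKernel {g : ℝ → ℝ} (hg : ContDiff ℝ 1 g) (c : ℝ) :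
    Measurable (poleKernel g c) := by
  have h1 : Measurable g := hg.continuous.measurable
  have h2 : Measurable (deriv g) := hg.continuous_deriv_one.measurable
  unfold poleKernel
  fun_prop

namespace HolderBump

variable {k : ℝ → ℝ} {R M K η : ℝ}

theorem integrable_graphKernel (hk : HolderBump k R M K η) {δ : ℝ} (hδ : 0 ≤ δ) (s : ℝ) :
    Integrable fun t ↦ graphKernel (fun u ↦ δ * k u) t s := by
  refine ((integral_colMaj (R := R) (M := M) (K := K) hk.exponent_pos s).1.const_mul δ).mono'
    ?_ (Eventually.of_forall fun t ↦ ?_)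
  · exact ((measurable_graphKernel (contDiff_const.mul hk.contDiff)).comp
      measurable_prodMk_right).aestronglyMeasurable
  · exact (abs_graphKernel_le k hδ t s).trans (mul_le_mul_of_nonneg_left
      (hk.taylorQuot_le_col t s) hδ)

theorem tendsto_slope_cocompact (hk : HolderBump k R M K η) (δ s : ℝ) {l : Filter ℝ}
    (hl : Tendsto (fun t : ℝ ↦ |t|) l atTop) (hl2 : Tendsto (fun t : ℝ ↦ (t - s)⁻¹) l (𝓝 0)) :
    Tendsto (dslope (fun u ↦ δ * k u) s) l (𝓝 0) := by
  have h : (fun t ↦ (t - s)⁻¹ * -(δ * k s)) =ᶠ[l] dslope (fun u ↦ δ * k u) s := by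
    filter_upwards [hl.eventually_gt_atTop (max R |s|)] with t ht
    have hts : t ≠ s := by
      rintro rfl
      exact absurd (le_max_right R |t|) (not_le.2 ht)
    rw [dslope_of_ne _ hts, slope_def_field, hk.eq_zero t ((le_max_left _ _).trans_lt ht)]
    ring
  refine Tendsto.congr' h ?_
  simpa using hl2.mul_const (-(δ * k s))

/-- Off the diagonal, `-2π · graphKernel g t s` is the derivative in `t` of the angle of the chord,
the arctangent of the slope, which is continuous across `t = s` and vanishes at `±∞`. -/
theorem integral_graphKernel (hk : HolderBump k R M K η) {δ : ℝ} (hδ : 0 ≤ δ) (s : ℝ) :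
    ∫ t, graphKernel (fun u ↦ δ * k u) t s = 0 := by
  set g : ℝ → ℝ := fun u ↦ δ * k u with hg
  have hgd : Differentiable ℝ g := hk.differentiable.const_mul δ
  set F : ℝ → ℝ := fun t ↦ -(1 / (2 * Real.pi)) * Real.arctan (dslope g s t) with hF
  have hcont : ContinuousAt F s :=
    (Real.continuous_arctan.continuousAt.comp (continuousAt_dslope_same.2 (hgd s))).const_mul _
  have hder : ∀ t, t ≠ s → HasDerivAt F (graphKernel g t s) t := by
    intro t ht
    have hts : t - s ≠ 0 := sub_ne_zero.2 ht
    have h1 : HasDerivAt (fun u ↦ (g u - g s) / (u - s))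
        ((deriv g t * (t - s) - (g t - g s) * 1) / (t - s) ^ 2) t :=
      ((hgd t).hasDerivAt.sub_const (g s)).div ((hasDerivAt_id t).sub_const s) hts
    have h2 : HasDerivAt (dslope g s) _ t := h1.congr_of_eventuallyEq (by
      filter_upwards [isOpen_ne.mem_nhds ht] with u hu
      rw [dslope_of_ne _ hu, slope_def_field])
    have h3 := h2.arctan.const_mul (-(1 / (2 * Real.pi)))
    refine h3.congr_deriv ?_
    rw [dslope_of_ne _ ht, slope_def_field, graphKernel]
    have : (t - s) ^ 2 + (g t - g s) ^ 2 ≠ 0 := by positivity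
    field_simp
    ring
  have hint := hk.integrable_graphKernel hδ s
  have hlim : ∀ {l : Filter ℝ}, Tendsto (fun t : ℝ ↦ |t|) l atTop →
      Tendsto (fun t : ℝ ↦ (t - s)⁻¹) l (𝓝 0) → Tendsto F l (𝓝 0) := fun hl hl2 ↦ by
    have := (Real.continuous_arctan.tendsto 0).comp (hk.tendsto_slope_cocompact δ s hl hl2)
    simpa [hF] using this.const_mul (-(1 / (2 * Real.pi)))
  have htop := hlim tendsto_abs_atTop_atTop
    (tendsto_inv_atTop_zero.comp (tendsto_atTop_add_const_right _ (-s) tendsto_id))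
  have hbot := hlim tendsto_abs_atBot_atTop
    (tendsto_inv_atBot_zero.comp (tendsto_atBot_add_const_right _ (-s) tendsto_id))
  rw [← setIntegral_univ, ← Set.Iic_union_Ioi (a := s),
    setIntegral_union (Set.Iic_disjoint_Ioi le_rfl) measurableSet_Ioi hint.integrableOn
      hint.integrableOn,
    integral_Iic_of_hasDerivAt_of_tendsto hcont.continuousWithinAt (fun t ht ↦ hder t ht.ne)
      hint.integrableOn hbot,
    integral_Ioi_of_hasDerivAt_of_tendsto hcont.continuousWithinAt (fun t ht ↦ hder t ht.ne')
      hint.integrableOn htop]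
  ring

theorem abs_poleKernel_le (hk : HolderBump k R M K η) {δ c : ℝ} (hδ : 0 ≤ δ) (hδ1 : δ ≤ 1)
    (hc : 0 < c) (hM : δ * M ≤ c / 2) (t : ℝ) :
    |poleKernel (fun u ↦ δ * k u) c t| ≤ (M * R + 2 * c) * (1 + 4 / c ^ 2) * (1 + t ^ 2)⁻¹ := by
  have hM0 := hk.bound_nonneg
  have hR := hk.radius_pos
  have hpi : (1 : ℝ) / (2 * Real.pi) ≤ 1 := by
    rw [div_le_one (by positivity)]; linarith [Real.pi_gt_three]
  have hg : |δ * k t| ≤ c / 2 := by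
    rw [abs_mul, abs_of_nonneg hδ]
    exact (mul_le_mul_of_nonneg_left (hk.abs_le t) hδ).trans hM
  obtain ⟨hg1, hg2⟩ := _root_.abs_le.1 hg
  have hD : 0 < t ^ 2 + (c - δ * k t) ^ 2 := by nlinarith
  rw [poleKernel, deriv_const_mul_field', abs_mul,
    abs_of_pos (by positivity : (0:ℝ) < 1 / (2 * Real.pi)),
    abs_div, abs_of_pos hD]
  have h1 : |δ * deriv k t * t + (c - δ * k t)| ≤ M * R + 2 * c := by
    have h2 : |δ * deriv k t * t| ≤ M * R := by
      rcases le_or_gt |t| R with ht | ht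
      · rw [abs_mul, abs_mul, abs_of_nonneg hδ]
        have := mul_le_mul hδ1 (hk.abs_deriv_le t) (abs_nonneg _) zero_le_one
        rw [one_mul] at this
        exact mul_le_mul this ht (abs_nonneg _) hM0
      · rw [hk.deriv_eq_zero ht]; simp; positivity
    refine (abs_add_le _ _).trans (add_le_add h2 (_root_.abs_le.2 ⟨?_, ?_⟩)) <;> linarith
  have h3 : (t ^ 2 + (c - δ * k t) ^ 2)⁻¹ ≤ (1 + 4 / c ^ 2) * (1 + t ^ 2)⁻¹ := by
    rw [← div_eq_mul_inv, inv_le_comm₀ hD (by positivity), inv_div, div_le_iff₀ (by positivity)]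
    have h4 : (c / 2) ^ 2 ≤ (c - δ * k t) ^ 2 := by gcongr; linarith
    have h5 : (1 + 4 / c ^ 2) * (c / 2) ^ 2 = c ^ 2 / 4 + 1 := by field_simp; norm_num
    have h6 : 0 ≤ t ^ 2 * (4 / c ^ 2) := by positivity
    have h7 : (t ^ 2 + (c / 2) ^ 2) * (1 + 4 / c ^ 2) ≤
      (t ^ 2 + (c - δ * k t) ^ 2) * (1 + 4 / c ^ 2) := by gcongr
    nlinarith [sq_nonneg c]
  calc _ ≤ 1 * ((M * R + 2 * c) * ((1 + 4 / c ^ 2) * (1 + t ^ 2)⁻¹)) := by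
        rw [div_eq_mul_inv |_|]
        exact mul_le_mul hpi (mul_le_mul h1 h3 (by positivity) (by positivity)) (by positivity)
          zero_le_one
    _ = _ := by ring

/-- `2π · poleKernel g c t` is the derivative of the angle `arctan (t / (c - g t))`. -/
theorem integral_poleKernel (hk : HolderBump k R M K η) {δ c : ℝ} (hδ : 0 ≤ δ) (hδ1 : δ ≤ 1)
    (hc : 0 < c) (hM : δ * M ≤ c / 2) : ∫ t, poleKernel (fun u ↦ δ * k u) c t = 1 / 2 := by
  have hg : ∀ t, 0 < c - δ * k t := fun t ↦ by
    have : δ * k t ≤ δ * M := mul_le_mul_of_nonneg_left ((le_abs_self _).trans (hk.abs_le t)) hδ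
    linarith
  set g : ℝ → ℝ := fun u ↦ δ * k u with hgdef
  have hgd : Differentiable ℝ g := hk.differentiable.const_mul δ
  have hder : ∀ t, HasDerivAt (fun t ↦ 1 / (2 * Real.pi) * Real.arctan (t / (c - g t)))
      (poleKernel g c t) t := by
    intro t
    have h0 : c - g t ≠ 0 := (hg t).ne'
    have h1 := ((hasDerivAt_id t).div ((hgd t).hasDerivAt.const_sub c) h0).arctan.const_mul
      (1 / (2 * Real.pi))
    refine h1.congr_deriv ?_
    have h2 : t ^ 2 + (c - g t) ^ 2 ≠ 0 := by positivity
    simp only [poleKernel, id, Pi.div_apply]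
    field_simp
    ring
  have hint : Integrable (poleKernel g c) :=
    (integrable_inv_one_add_sq.const_mul _).mono'
      (measurable_poleKernel (contDiff_const.mul hk.contDiff) c).aestronglyMeasurable
      (Eventually.of_forall (hk.abs_poleKernel_le hδ hδ1 hc hM))
  have hev : ∀ t, R < |t| → t / (c - g t) = t / c := fun t ht ↦ by
    simp [hgdef, hk.eq_zero t ht]
  have htop : Tendsto (fun t ↦ 1 / (2 * Real.pi) * Real.arctan (t / (c - g t))) atTop
      (𝓝 (1 / (2 * Real.pi) * (Real.pi / 2))) := by
    refine ((tendsto_nhds_of_tendsto_nhdsWithin Real.tendsto_arctan_atTop).comp ?_).const_mul _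
    refine (tendsto_id.atTop_div_const hc).congr' ?_
    filter_upwards [tendsto_abs_atTop_atTop.eventually_gt_atTop R] with t ht
    exact (hev t ht).symm
  have hbot : Tendsto (fun t ↦ 1 / (2 * Real.pi) * Real.arctan (t / (c - g t))) atBot
      (𝓝 (1 / (2 * Real.pi) * (-(Real.pi / 2)))) := by
    refine ((tendsto_nhds_of_tendsto_nhdsWithin Real.tendsto_arctan_atBot).comp ?_).const_mul _
    refine (tendsto_id.atBot_div_const hc).congr' ?_
    filter_upwards [tendsto_abs_atBot_atTop.eventually_gt_atTop R] with t ht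
    exact (hev t ht).symm
  rw [integral_of_hasDerivAt_of_tendsto hder hint hbot htop]
  field_simp
  ring

end HolderBump

/-- The measure `ρ dt` on the line. -/
noncomputable def densityMeasure (ρ : ℝ → ℝ) : Measure ℝ :=
  volume.withDensity fun t ↦ ENNReal.ofReal (ρ t)

theorem lintegral_densityMeasure {ρ : ℝ → ℝ} (hρ : Measurable ρ) (hpos : ∀ t, 0 ≤ ρ t) (f : ℝ → ℝ) :
    ∫⁻ t, ‖f t‖ₑ ∂densityMeasure ρ = ∫⁻ t, ENNReal.ofReal (ρ t * |f t|) := by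
  rw [densityMeasure, lintegral_withDensity_eq_lintegral_mul_non_measurable _ hρ.ennreal_ofReal
    (Eventually.of_forall fun t ↦ ENNReal.ofReal_lt_top)]
  simp [ENNReal.ofReal_mul (hpos _), ← ofReal_norm]

theorem integral_densityMeasure {E : Type*} [NormedAddCommGroup E] [NormedSpace ℝ E] {ρ : ℝ → ℝ}
    (hρ : Measurable ρ) (hpos : ∀ t, 0 ≤ ρ t) (f : ℝ → E) :
    ∫ t, f t ∂densityMeasure ρ = ∫ t, ρ t • f t := by
  rw [densityMeasure, integral_withDensity_eq_integral_toReal_smul hρ.ennreal_ofReal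
    (Eventually.of_forall fun t ↦ ENNReal.ofReal_lt_top)]
  simp [ENNReal.toReal_ofReal (hpos _)]

/-- The kernel `graphKernel g t s / ρ t` has Schur norm `O(δ)` on `L²(ρ dt)` for `g = δ k`, when
`ρ` is comparable to `1 / (1 + t²)`; the constant does not
depend on `δ`, and depends on `ρ` through its bounds only. -/
theorem HolderBump.exists_isSchurKernel {k : ℝ → ℝ} {R M K η : ℝ} (hk : HolderBump k R M K η)
    {lo hi : ℝ} (hlo : 0 < lo) (hhi : 0 < hi) :
    ∃ B : ℝ≥0, ∀ (δ : ℝ≥0) (ρ : ℝ → ℝ), Measurable ρ → (∀ t, lo * (1 + t ^ 2)⁻¹ ≤ ρ t) →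
      (∀ t, ρ t ≤ hi * (1 + t ^ 2)⁻¹) →
      IsSchurKernel (densityMeasure ρ) (fun t s ↦ graphKernel (fun u ↦ δ * k u) t s / ρ t)
        (δ * B) := by
  set Bc : ℝ≥0 := Real.toNNReal (∫ t, colMaj R M K η t t)
  set Br : ℝ≥0 := Real.toNNReal (hi / lo * ∫ t, rowMaj R M K η t t)
  refine ⟨max Bc Br, fun δ ρ hρm hρlo hρhi ↦ ?_⟩
  have hpos : ∀ t, 0 < ρ t := fun t ↦ lt_of_lt_of_le (by positivity) (hρlo t)
  have hmeas := measurable_graphKernel (contDiff_const (c := (δ : ℝ)).mul hk.contDiff)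
  refine ⟨hmeas.div (hρm.comp measurable_fst), fun t ↦ ?_, fun s ↦ ?_⟩
  · rw [lintegral_densityMeasure hρm fun t ↦ (hpos t).le]
    obtain ⟨h1, h2⟩ := integral_rowMaj (R := R) (M := M) (K := K) hk.exponent_pos t
    have hle : ∀ s, ρ s * |graphKernel (fun u ↦ δ * k u) t s / ρ t| ≤
        δ * (hi / lo * rowMaj R M K η s (t - s)) := fun s ↦ by
      have hq : ρ s / ρ t ≤ hi / lo * ((1 + t ^ 2) / (1 + s ^ 2)) := by
        calc ρ s / ρ t ≤ (hi * (1 + s ^ 2)⁻¹) / (lo * (1 + t ^ 2)⁻¹) :=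
              div_le_div₀ (by positivity) (hρhi s) (by positivity) (hρlo t)
          _ = _ := by field_simp
      have h0 : 0 ≤ taylorQuot k t s := by unfold taylorQuot; positivity
      calc ρ s * |graphKernel (fun u ↦ δ * k u) t s / ρ t|
          = |graphKernel (fun u ↦ δ * k u) t s| * (ρ s / ρ t) := by
            rw [abs_div, abs_of_pos (hpos t)]; ring
        _ ≤ (δ * taylorQuot k t s) * (hi / lo * ((1 + t ^ 2) / (1 + s ^ 2))) :=
            mul_le_mul (abs_graphKernel_le k δ.2 t s) hq (div_pos (hpos s) (hpos t)).le
              (by positivity)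
        _ = δ * (hi / lo * (taylorQuot k t s * ((1 + t ^ 2) / (1 + s ^ 2)))) := by ring
        _ ≤ _ := by gcongr; exact hk.taylorQuot_mul_le_row t s
    have h3 := (h1.const_mul (hi / lo)).const_mul (δ : ℝ)
    calc _ ≤ ∫⁻ s, ENNReal.ofReal (δ * (hi / lo * rowMaj R M K η s (t - s))) :=
          lintegral_mono fun s ↦ ENNReal.ofReal_le_ofReal (hle s)
      _ = ENNReal.ofReal (∫ s, δ * (hi / lo * rowMaj R M K η s (t - s))) :=
          (ofReal_integral_eq_lintegral_ofReal h3 (Eventually.of_forall fun s ↦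
            (mul_nonneg (hpos s).le (abs_nonneg _)).trans (hle s))).symm
      _ = (δ * Br : ℝ≥0) := by
          rw [integral_const_mul, integral_const_mul, h2, ENNReal.ofReal_mul δ.coe_nonneg]
          simp [Br, ENNReal.ofReal]
      _ ≤ _ := by gcongr; exact le_max_right _ _
  · rw [lintegral_densityMeasure hρm fun t ↦ (hpos t).le]
    obtain ⟨h1, h2⟩ := integral_colMaj (R := R) (M := M) (K := K) hk.exponent_pos s
    have hle : ∀ t, ρ t * |graphKernel (fun u ↦ δ * k u) t s / ρ t| ≤
        δ * colMaj R M K η t (t - s) := fun t ↦ by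
      rw [abs_div, abs_of_pos (hpos t), mul_div_cancel₀ _ (hpos t).ne']
      exact (abs_graphKernel_le k δ.2 t s).trans
        (mul_le_mul_of_nonneg_left (hk.taylorQuot_le_col t s) δ.2)
    have h3 := h1.const_mul (δ : ℝ)
    calc _ ≤ ∫⁻ t, ENNReal.ofReal (δ * colMaj R M K η t (t - s)) :=
          lintegral_mono fun s ↦ ENNReal.ofReal_le_ofReal (hle s)
      _ = ENNReal.ofReal (∫ t, δ * colMaj R M K η t (t - s)) :=
          (ofReal_integral_eq_lintegral_ofReal h3 (Eventually.of_forall fun s ↦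
            (mul_nonneg (hpos s).le (abs_nonneg _)).trans (hle s))).symm
      _ = (δ * Bc : ℝ≥0) := by
          rw [integral_const_mul, h2, ENNReal.ofReal_mul δ.coe_nonneg]
          simp [Bc, ENNReal.ofReal]
      _ ≤ _ := by gcongr; exact le_max_left _ _

/-! ### Differentiating the single layer potential -/

namespace Plasmon

/-- The differential at `w` of `(1/2π) ln |w|`. -/
noncomputable def gradFundSol (w : ℂ) : ℂ →L[ℝ] ℝ :=
  (1 / (2 * Real.pi) * (‖w‖ ^ 2)⁻¹) • innerSL ℝ w

theorem gradFundSol_apply (w v : ℂ) :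
    gradFundSol w v = 1 / (2 * Real.pi) * (v / w).re := by
  have h1 : inner ℝ w v = (v / w).re * ‖w‖ ^ 2 := by
    rcases eq_or_ne w 0 with rfl | hw
    · simp
    have : Complex.normSq w ≠ 0 := by simpa using hw
    rw [Complex.inner, Complex.div_re, ← Complex.normSq_eq_norm_sq]
    simp only [Complex.mul_re, Complex.conj_re, Complex.conj_im]
    field_simp
    ring
  have h2 : gradFundSol w v = 1 / (2 * Real.pi) * (‖w‖ ^ 2)⁻¹ * inner ℝ w v := by
    simp [gradFundSol]
  rw [h2, h1]
  rcases eq_or_ne w 0 with rfl | hw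
  · simp
  have : ‖w‖ ≠ 0 := by simpa using hw
  field_simp

theorem norm_gradFundSol_le (w : ℂ) : ‖gradFundSol w‖ ≤ ‖w‖⁻¹ := by
  have hpi : (1 : ℝ) / (2 * Real.pi) ≤ 1 := by
    rw [div_le_one (by positivity)]; linarith [Real.pi_gt_three]
  rw [gradFundSol, norm_smul, innerSL_apply_norm, Real.norm_of_nonneg (by positivity), mul_assoc]
  rcases eq_or_ne w 0 with rfl | hw
  · simp
  have h0 : 0 < ‖w‖ := norm_pos_iff.2 hw
  have : (‖w‖ ^ 2)⁻¹ * ‖w‖ = ‖w‖⁻¹ := by field_simp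
  rw [this]
  exact mul_le_of_le_one_left (by positivity) hpi

theorem measurable_gradFundSol : Measurable gradFundSol := by
  have h1 : Measurable fun w : ℂ ↦ innerSL ℝ w := (innerSL ℝ).continuous.measurable
  have h2 : Measurable fun w : ℂ ↦ 1 / (2 * Real.pi) * (‖w‖ ^ 2)⁻¹ := by fun_prop
  exact h2.smul h1

theorem hasFDerivAt_fundSol {x y : ℂ} (h : x ≠ y) :
    HasFDerivAt (fun z ↦ fundSol z y) (gradFundSol (x - y)) x := by
  have h0 : ‖x - y‖ ≠ 0 := norm_ne_zero_iff.2 (sub_ne_zero.2 h)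
  have h1 := (((hasFDerivAt_id x).sub_const y).norm_sq.log (pow_ne_zero 2 h0)).const_mul
    (1 / (2 * Real.pi) * (1 / 2))
  have h2 : (fun z ↦ fundSol z y) =
      fun z ↦ 1 / (2 * Real.pi) * (1 / 2) * Real.log (‖id z - y‖ ^ 2) := by
    ext z
    rw [fundSol, Real.log_pow, id]
    push_cast
    ring
  rw [h2]
  refine h1.congr_fderiv ?_
  ext v
  all_goals
    simp only [gradFundSol, smul_apply, ContinuousLinearMap.comp_apply, id,
      ContinuousLinearMap.id_apply, smul_eq_mul, nsmul_eq_mul]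
    push_cast
    ring

namespace Curve

variable (C : Curve)

theorem abs_fundSol_le {x y : ℂ} (h : x ≠ y) : |fundSol x y| ≤ ‖x - y‖ + ‖x - y‖⁻¹ := by
  have h0 : 0 < ‖x - y‖ := norm_pos_iff.2 (sub_ne_zero.2 h)
  have hpi : (1 : ℝ) / (2 * Real.pi) ≤ 1 := by
    rw [div_le_one (by positivity)]; linarith [Real.pi_gt_three]
  have h1 := Real.log_le_sub_one_of_pos h0
  have h2 := Real.log_le_sub_one_of_pos (inv_pos.2 h0)
  rw [Real.log_inv] at h2
  have h3 : |Real.log ‖x - y‖| ≤ ‖x - y‖ + ‖x - y‖⁻¹ := by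
    have := inv_pos.2 h0
    rw [abs_le]; constructor <;> linarith
  rw [fundSol, abs_mul, abs_of_pos (by positivity : (0 : ℝ) < 1 / (2 * Real.pi))]
  exact (mul_le_of_le_one_left (abs_nonneg _) hpi).trans h3

theorem measurable_fundSol (x : ℂ) : Measurable fun y ↦ (fundSol x y : ℂ) := by
  unfold fundSol
  fun_prop

theorem integrable_fundSol_mul {φ : ℂ → ℂ} (hφ : Integrable φ C.σ) {ε L : ℝ} (hε : 0 < ε) {x : ℂ}
    (hx : ∀ᵐ y ∂C.σ, ε ≤ ‖x - y‖) (hL : ∀ᵐ y ∂C.σ, ‖y‖ ≤ L) :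
    Integrable (fun y ↦ (fundSol x y : ℂ) * φ y) C.σ := by
  refine hφ.bdd_mul (c := ‖x‖ + L + ε⁻¹) (measurable_fundSol x).aestronglyMeasurable ?_
  filter_upwards [hx, hL] with y h1 h2
  have hxy : x ≠ y := by
    rintro rfl
    rw [sub_self, norm_zero] at h1
    linarith
  rw [Complex.norm_real]
  exact (abs_fundSol_le hxy).trans (add_le_add ((norm_sub_le _ _).trans (by gcongr))
    (inv_anti₀ hε h1))

/-- Off the support of `σ` the single layer potential may be differentiated under the integral. -/
theorem hasFDerivAt_S {φ : ℂ → ℂ} (hφ : Integrable φ C.σ) {ε L : ℝ} (hε : 0 < ε) {x : ℂ}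
    (hx : ∀ᵐ y ∂C.σ, ε ≤ ‖x - y‖) (hL : ∀ᵐ y ∂C.σ, ‖y‖ ≤ L) :
    HasFDerivAt (C.S φ) (∫ y, (gradFundSol (x - y)).smulRight (φ y) ∂C.σ) x := by
  have hball : ∀ᵐ y ∂C.σ, ∀ z ∈ Metric.ball x (ε / 2), ε / 2 ≤ ‖z - y‖ := by
    filter_upwards [hx] with y hy z hz
    rw [Metric.mem_ball, dist_eq_norm] at hz
    have : ‖x - y‖ ≤ ‖z - x‖ + ‖z - y‖ := by
      have := norm_sub_le (z - y) (z - x)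
      rw [sub_sub_sub_cancel_left] at this
      linarith
    linarith
  refine hasFDerivAt_integral_of_dominated_of_fderiv_le
    (F := fun x y ↦ (fundSol x y : ℂ) * φ y)
    (F' := fun x y ↦ (gradFundSol (x - y)).smulRight (φ y))
    (bound := fun y ↦ (ε / 2)⁻¹ * ‖φ y‖)
    (Metric.ball_mem_nhds x (half_pos hε)) ?_ ?_ ?_ ?_ ?_ ?_
  · exact Eventually.of_forall fun z ↦ (measurable_fundSol z).aestronglyMeasurable.mul hφ.1
  · exact C.integrable_fundSol_mul hφ hε hx hL
  · exact (ContinuousLinearMap.smulRightL ℝ ℂ ℂ).aestronglyMeasurable_comp₂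
      (measurable_gradFundSol.comp (measurable_const.sub measurable_id)).aestronglyMeasurable hφ.1
  · filter_upwards [hball] with y hy z hz
    rw [ContinuousLinearMap.norm_smulRight_apply]
    gcongr
    exact (norm_gradFundSol_le _).trans (inv_anti₀ (half_pos hε) (hy z hz))
  · exact hφ.norm.const_mul _
  · filter_upwards [hball] with y hy z hz
    have hzy : z ≠ y := by
      rintro rfl
      have := hy z hz
      rw [sub_self, norm_zero] at this
      linarith
    have := ((hasFDerivAt_fundSol hzy).smul_const (φ y))
    simpa only [Complex.real_smul] using this

theorem norm_fderiv_S_le {φ : ℂ → ℂ} (hφ : Integrable φ C.σ) {ε L : ℝ} (hε : 0 < ε) {x : ℂ}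
    (hx : ∀ᵐ y ∂C.σ, ε ≤ ‖x - y‖) (hL : ∀ᵐ y ∂C.σ, ‖y‖ ≤ L) :
    ‖fderiv ℝ (C.S φ) x‖ ≤ ε⁻¹ * ∫ y, ‖φ y‖ ∂C.σ := by
  rw [(C.hasFDerivAt_S hφ hε hx hL).fderiv, ← integral_const_mul]
  refine norm_integral_le_of_norm_le (hφ.norm.const_mul _) ?_
  filter_upwards [hx] with y hy
  rw [ContinuousLinearMap.norm_smulRight_apply]
  gcongr
  exact (norm_gradFundSol_le _).trans (inv_anti₀ hε hy)

theorem npKernel_eq {x y : ℂ} (h : x ≠ y) :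
    C.npKernel x y = 1 / (2 * Real.pi) * (C.ν x / (x - y)).re := by
  rw [npKernel, dn, (hasFDerivAt_fundSol h).fderiv, gradFundSol_apply]

end Curve

end Plasmon

/-! ### The Möbius map and the image of a graph -/

namespace Plasmon

theorem focus_pos {d r : ℝ} (hr : 0 < r) (hd : r < d) : 0 < focus d r :=
  Real.sqrt_pos.2 (by nlinarith)

theorem focus_sq {d r : ℝ} (hr : 0 < r) (hd : r < d) : focus d r ^ 2 = d ^ 2 - r ^ 2 :=
  Real.sq_sqrt (by nlinarith)

section Moebius

variable {d r : ℝ}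

theorem I_mul_focus_ne_zero (hc : 0 < focus d r) : Complex.I * (focus d r : ℂ) ≠ 0 :=
  mul_ne_zero Complex.I_ne_zero (by exact_mod_cast hc.ne')

theorem Phi_ne_one (hc : 0 < focus d r) (z : ℂ) : Phi d r z ≠ 1 := by
  intro h
  have hI := I_mul_focus_ne_zero hc
  rw [Phi] at h
  rcases eq_or_ne (z - Complex.I * focus d r) 0 with h0 | h0
  · rw [h0, div_zero] at h; exact zero_ne_one h
  · rw [div_eq_one_iff_eq h0] at h
    exact hI (by linear_combination h / 2)

theorem Phi_sub_one {z : ℂ} (hz : z - Complex.I * focus d r ≠ 0) :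
    Phi d r z - 1 = 2 * (Complex.I * focus d r) / (z - Complex.I * focus d r) := by
  rw [Phi]; field_simp; ring

theorem PhiInv_Phi (hc : 0 < focus d r) {z : ℂ} (hz : z - Complex.I * focus d r ≠ 0) :
    PhiInv d r (Phi d r z) = z := by
  have hI := I_mul_focus_ne_zero hc
  rw [PhiInv, Phi_sub_one hz, Phi, div_eq_iff (div_ne_zero (mul_ne_zero two_ne_zero hI) hz)]
  field_simp
  ring

theorem PhiInv_sub {w : ℂ} (hw : w ≠ 1) :
    PhiInv d r w - Complex.I * focus d r = 2 * (Complex.I * focus d r) / (w - 1) := by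
  have : w - 1 ≠ 0 := sub_ne_zero.2 hw
  rw [PhiInv]; field_simp; ring

theorem PhiInv_sub_ne_zero (hc : 0 < focus d r) {w : ℂ} (hw : w ≠ 1) :
    PhiInv d r w - Complex.I * focus d r ≠ 0 := by
  rw [PhiInv_sub hw]
  exact div_ne_zero (mul_ne_zero two_ne_zero (I_mul_focus_ne_zero hc)) (sub_ne_zero.2 hw)

theorem Phi_PhiInv (hc : 0 < focus d r) {w : ℂ} (hw : w ≠ 1) :
    Phi d r (PhiInv d r w) = w := by
  have hI := I_mul_focus_ne_zero hc
  have h1 : w - 1 ≠ 0 := sub_ne_zero.2 hw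
  rw [Phi, div_eq_iff (PhiInv_sub_ne_zero hc hw), PhiInv_sub hw, PhiInv]
  field_simp
  ring

theorem hasDerivAt_Phi {z : ℂ} (hz : z - Complex.I * focus d r ≠ 0) :
    HasDerivAt (Phi d r) (-2 * (Complex.I * focus d r) / (z - Complex.I * focus d r) ^ 2) z := by
  have h := ((hasDerivAt_id z).add_const (Complex.I * focus d r)).div
    ((hasDerivAt_id z).sub_const (Complex.I * focus d r)) hz
  refine h.congr_deriv ?_
  simp only [id]
  ring

theorem hasDerivAt_PhiInv {w : ℂ} (hw : w ≠ 1) :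
    HasDerivAt (PhiInv d r) (-2 * (Complex.I * focus d r) / (w - 1) ^ 2) w := by
  have h := (((hasDerivAt_id w).add_const 1).const_mul (Complex.I * focus d r)).div
    ((hasDerivAt_id w).sub_const 1) (sub_ne_zero.2 hw)
  refine h.congr_deriv ?_
  simp only [id]
  ring

theorem Phi_sub_Phi {z w : ℂ} (hz : z - Complex.I * focus d r ≠ 0)
    (hw : w - Complex.I * focus d r ≠ 0) :
    Phi d r z - Phi d r w = -2 * (Complex.I * focus d r) * (z - w) /
      ((z - Complex.I * focus d r) * (w - Complex.I * focus d r)) := by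
  rw [Phi, Phi]; field_simp; ring

theorem differentiableAt_uIncT {w : ℂ} (hw : w ≠ 1) (a₁ a₂ : ℝ) :
    DifferentiableAt ℝ (uIncT d r a₁ a₂) w := by
  have h1 : DifferentiableAt ℝ (PhiInv d r) w :=
    (hasDerivAt_PhiInv hw).differentiableAt.restrictScalars ℝ
  have h2 : Differentiable ℝ (uInc a₁ a₂) := by
    have : uInc a₁ a₂ = fun z ↦
        Complex.ofRealCLM (-(a₁ * Complex.reCLM z + a₂ * Complex.imCLM z)) := by
      ext z; simp [uInc]
    rw [this]
    fun_prop
  exact (h2 _).comp w h1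

end Moebius

/-- The point `-t + i g(t)`: the graph of `u ↦ g (-u)`, run from right to left. -/
noncomputable def graphPt (g : ℝ → ℝ) (t : ℝ) : ℂ := (-t : ℝ) + (g t : ℝ) * Complex.I

section GraphPt

variable {g : ℝ → ℝ} {d r : ℝ}

theorem graphPt_re (t : ℝ) : (graphPt g t).re = -t := by simp [graphPt]

theorem graphPt_im (t : ℝ) : (graphPt g t).im = g t := by simp [graphPt]

theorem hasDerivAt_graphPt (hg : Differentiable ℝ g) (t : ℝ) :
    HasDerivAt (graphPt g) (-1 + deriv g t * Complex.I) t := by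
  have h1 : HasDerivAt (fun t : ℝ ↦ ((-t : ℝ) : ℂ)) ((-1 : ℝ) : ℂ) t :=
    (hasDerivAt_neg t).ofReal_comp
  have h2 := h1.add ((hg t).hasDerivAt.ofReal_comp.mul_const Complex.I)
  refine h2.congr_deriv ?_
  simp

theorem graphPt_sub_ne_zero (hg : ∀ t, g t < focus d r) (t : ℝ) :
    graphPt g t - Complex.I * focus d r ≠ 0 := by
  intro h
  have := congrArg Complex.im h
  simp [graphPt] at this
  linarith [hg t]

theorem hasDerivAt_Phi_graphPt (hg : Differentiable ℝ g) (hgc : ∀ t, g t < focus d r) (t : ℝ) :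
    HasDerivAt (fun t ↦ Phi d r (graphPt g t))
      (-2 * (Complex.I * focus d r) / (graphPt g t - Complex.I * focus d r) ^ 2 *
        (-1 + deriv g t * Complex.I)) t :=
  (hasDerivAt_Phi (graphPt_sub_ne_zero hgc t)).comp t (hasDerivAt_graphPt hg t)

theorem injective_Phi_graphPt (hc : 0 < focus d r) (hgc : ∀ t, g t < focus d r) :
    Function.Injective fun t ↦ Phi d r (graphPt g t) := fun t s h ↦ by
  have h1 := congrArg (PhiInv d r) h
  simp only [PhiInv_Phi hc (graphPt_sub_ne_zero hgc _)] at h1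
  have h2 := congrArg Complex.re h1
  rw [graphPt_re, graphPt_re] at h2
  linarith

theorem deriv_Phi_graphPt_ne_zero (hg : Differentiable ℝ g) (hc : 0 < focus d r)
    (hgc : ∀ t, g t < focus d r) (t : ℝ) : deriv (fun t ↦ Phi d r (graphPt g t)) t ≠ 0 := by
  rw [(hasDerivAt_Phi_graphPt hg hgc t).deriv]
  refine mul_ne_zero (div_ne_zero (mul_ne_zero (by norm_num) (I_mul_focus_ne_zero hc))
    (pow_ne_zero 2 (graphPt_sub_ne_zero hgc t))) fun h ↦ ?_
  have := congrArg Complex.re h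
  simp at this

theorem contDiff_Phi_graphPt (hg : ContDiff ℝ 1 g) (hgc : ∀ t, g t < focus d r) :
    ContDiff ℝ 1 fun t ↦ Phi d r (graphPt g t) := by
  have h1 : ContDiff ℝ 1 (graphPt g) :=
    (Complex.ofRealCLM.contDiff.comp contDiff_neg).add
      ((Complex.ofRealCLM.contDiff.comp hg).mul contDiff_const)
  simp only [Phi, div_eq_mul_inv]
  exact (h1.add contDiff_const).mul ((h1.sub contDiff_const).inv (graphPt_sub_ne_zero hgc))

theorem normSq_graphPt_sub (t : ℝ) :
    ‖graphPt g t - Complex.I * focus d r‖ ^ 2 = t ^ 2 + (focus d r - g t) ^ 2 := by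
  rw [← Complex.normSq_eq_norm_sq, Complex.normSq_apply]
  simp [graphPt]
  ring

theorem norm_deriv_Phi_graphPt (hg : Differentiable ℝ g) (hc : 0 < focus d r)
    (hgc : ∀ t, g t < focus d r) (t : ℝ) :
    ‖deriv (fun t ↦ Phi d r (graphPt g t)) t‖ =
      2 * focus d r * Real.sqrt (1 + deriv g t ^ 2) / (t ^ 2 + (focus d r - g t) ^ 2) := by
  have h1 : ‖(-1 : ℂ) + deriv g t * Complex.I‖ = Real.sqrt (1 + deriv g t ^ 2) := by
    rw [Complex.norm_def, Complex.normSq_apply]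
    congr 1
    simp
    ring
  rw [(hasDerivAt_Phi_graphPt hg hgc t).deriv, norm_mul, norm_div, norm_pow, normSq_graphPt_sub, h1]
  simp [abs_of_pos hc]
  ring

theorem sqrt_one_add_sq_le {x M : ℝ} (hx : |x| ≤ M) : Real.sqrt (1 + x ^ 2) ≤ 1 + M := by
  have hM := (abs_nonneg x).trans hx
  rw [Real.sqrt_le_left (by positivity), ← sq_abs x]
  nlinarith [abs_nonneg x]

theorem le_norm_deriv_Phi_graphPt (hg : Differentiable ℝ g) (hc : 0 < focus d r)
    (hgc : ∀ t, |g t| ≤ focus d r / 2) (t : ℝ) :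
    2 * focus d r / (1 + 9 * focus d r ^ 2 / 4) * (1 + t ^ 2)⁻¹ ≤
      ‖deriv (fun t ↦ Phi d r (graphPt g t)) t‖ := by
  have h := fun t ↦ abs_le.1 (hgc t)
  rw [norm_deriv_Phi_graphPt hg hc fun t ↦ by linarith [(h t).2]]
  set c := focus d r
  have h1 : 1 ≤ Real.sqrt (1 + deriv g t ^ 2) := by
    rw [Real.one_le_sqrt]; nlinarith [sq_nonneg (deriv g t)]
  have hD : 0 < t ^ 2 + (c - g t) ^ 2 := by nlinarith [(h t).2]
  rw [← div_eq_mul_inv, div_div]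
  have h3 : (c - g t) ^ 2 ≤ (3 * c / 2) ^ 2 := by
    apply pow_le_pow_left₀ <;> linarith [(h t).1, (h t).2]
  have h4 : t ^ 2 + (c - g t) ^ 2 ≤ (1 + 9 * c ^ 2 / 4) * (1 + t ^ 2) := by
    nlinarith [mul_nonneg (sq_nonneg c) (sq_nonneg t)]
  exact div_le_div₀ (by positivity) (le_mul_of_one_le_right (by positivity) h1) hD h4

theorem norm_deriv_Phi_graphPt_le (hg : Differentiable ℝ g) (hc : 0 < focus d r) {M : ℝ}
    (hgc : ∀ t, |g t| ≤ focus d r / 2) (hgM : ∀ t, |deriv g t| ≤ M) (t : ℝ) :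
    ‖deriv (fun t ↦ Phi d r (graphPt g t)) t‖ ≤
      2 * focus d r * (1 + M) * (1 + 4 / focus d r ^ 2) * (1 + t ^ 2)⁻¹ := by
  have h := fun t ↦ abs_le.1 (hgc t)
  rw [norm_deriv_Phi_graphPt hg hc fun t ↦ by linarith [(h t).2]]
  set c := focus d r
  have hM : 0 ≤ M := (abs_nonneg _).trans (hgM 0)
  have hD : 0 < t ^ 2 + (c - g t) ^ 2 := by nlinarith [(h t).2]
  rw [div_le_iff₀ hD, mul_assoc (2 * c * (1 + M)), mul_assoc (2 * c * (1 + M))]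
  have h1 : 1 ≤ (1 + 4 / c ^ 2) * (1 + t ^ 2)⁻¹ * (t ^ 2 + (c - g t) ^ 2) := by
    rw [mul_right_comm, ← div_eq_mul_inv, one_le_div (by positivity)]
    have h4 : (c / 2) ^ 2 ≤ (c - g t) ^ 2 := by
      apply pow_le_pow_left₀ <;> linarith [(h t).2]
    calc 1 + t ^ 2 ≤ (1 + 4 / c ^ 2) * (t ^ 2 + (c / 2) ^ 2) := by
          have h5 : (1 + 4 / c ^ 2) * (t ^ 2 + (c / 2) ^ 2) =
              1 + t ^ 2 + (4 / c ^ 2 * t ^ 2 + (c / 2) ^ 2) := by field_simp; ring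
          rw [h5]
          exact le_add_of_nonneg_right (by positivity)
      _ ≤ _ := by gcongr
  calc 2 * c * Real.sqrt (1 + deriv g t ^ 2) ≤ 2 * c * (1 + M) := by
        gcongr; exact sqrt_one_add_sq_le (hgM t)
    _ ≤ _ := le_mul_of_one_le_right (by positivity) h1

/-- Since `Φ'(z) / (Φ(z) - Φ(w)) = 1 / (z - w) - 1 / (z - ic)`, the Neumann-Poincaré kernel of the
image of a graph under `Φ`, times the speed, splits into the kernel of the graph and a function of
the first variable. -/
theorem kernel_Phi_graphPt (hg : Differentiable ℝ g) (hc : 0 < focus d r)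
    (hgc : ∀ t, g t < focus d r) {t s : ℝ} (hts : t ≠ s) :
    1 / (2 * Real.pi) * (-Complex.I * deriv (fun t ↦ Phi d r (graphPt g t)) t /
      (Phi d r (graphPt g t) - Phi d r (graphPt g s))).re =
      graphKernel g t s + poleKernel g (focus d r) t := by
  have hI := I_mul_focus_ne_zero hc
  have ht := graphPt_sub_ne_zero hgc t
  have hs := graphPt_sub_ne_zero hgc s
  have hsub : graphPt g t - graphPt g s ≠ 0 := fun h ↦ hts (by
    have := congrArg Complex.re h
    rw [Complex.sub_re, graphPt_re, graphPt_re, Complex.zero_re] at this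
    linarith)
  have h1 : -Complex.I * deriv (fun t ↦ Phi d r (graphPt g t)) t /
      (Phi d r (graphPt g t) - Phi d r (graphPt g s)) =
      (deriv g t + Complex.I) / (graphPt g t - graphPt g s) -
      (deriv g t + Complex.I) / (graphPt g t - Complex.I * focus d r) := by
    have h2 : -Complex.I * (-1 + deriv g t * Complex.I) = (deriv g t : ℝ) + Complex.I := by
      linear_combination (-((deriv g t : ℝ) : ℂ)) * Complex.I_mul_I
    rw [(hasDerivAt_Phi_graphPt hg hgc t).deriv, Phi_sub_Phi ht hs, ← h2,
      div_sub_div _ _ hsub ht, div_eq_div_iff (div_ne_zero (mul_ne_zero (mul_ne_zero (by norm_num)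
        hI) hsub) (mul_ne_zero ht hs)) (mul_ne_zero hsub ht)]
    field_simp
    ring
  have h3 : ((deriv g t + Complex.I) / (graphPt g t - graphPt g s)).re =
      (g t - g s - deriv g t * (t - s)) / ((t - s) ^ 2 + (g t - g s) ^ 2) := by
    have h4 : Complex.normSq (graphPt g t - graphPt g s) = (t - s) ^ 2 + (g t - g s) ^ 2 := by
      rw [Complex.normSq_apply]; simp [graphPt]; ring
    rw [Complex.div_re, h4, ← add_div]
    congr 1
    simp [graphPt]
    ring
  have h5 : ((deriv g t + Complex.I) / (graphPt g t - Complex.I * focus d r)).re =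
      -((deriv g t * t + (focus d r - g t)) / (t ^ 2 + (focus d r - g t) ^ 2)) := by
    rw [Complex.div_re, Complex.normSq_eq_norm_sq, normSq_graphPt_sub, ← add_div, ← neg_div]
    congr 1
    simp [graphPt]
    ring
  rw [h1, Complex.sub_re, h3, h5, graphKernel, poleKernel]
  ring

end GraphPt

end Plasmon

/-! ### Neumann-Poincaré operators in a parameter -/

namespace Plasmon

namespace Curve

variable {C : Curve}

theorem Kstar_comp_eq {μ : Measure ℝ} [NullSingletonClass μ] (hγ : MeasurableEmbedding C.γ)
    (hσ : C.σ = Measure.map C.γ μ) {a : ℝ → ℝ → ℝ}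
    (hker : ∀ t s, t ≠ s → C.npKernel (C.γ t) (C.γ s) = a t s) (φ : ℂ → ℂ) (t : ℝ) :
    C.Kstar φ (C.γ t) = kernelOp μ a (φ ∘ C.γ) t := by
  rw [Kstar, hσ, hγ.integral_map]
  refine integral_congr_ae ?_
  filter_upwards [compl_mem_ae_iff.2 (measure_singleton t)] with s hs
  rw [hker t s (fun h ↦ hs h.symm)]
  rfl

/-- Invertibility of `l - K*` read off in the parameter: `γ` carries `L²(μ)` to `L²(∂D)`. -/
theorem shiftInvertible_of_isSchurKernel {μ : Measure ℝ} [IsFiniteMeasure μ] [NullSingletonClass μ]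
    (hγ : MeasurableEmbedding C.γ) (hσ : C.σ = Measure.map C.γ μ) {a : ℝ → ℝ → ℝ} {q : ℝ → ℝ}
    {B : ℝ≥0} (ha : IsSchurKernel μ a B) (h0 : ∀ s, ∫ t, a t s ∂μ = 0) (hq : MemLp q 2 μ)
    (hq1 : ∫ t, q t ∂μ = 1 / 2)
    (hker : ∀ t s, t ≠ s → C.npKernel (C.γ t) (C.γ s) = a t s + q t) {l : ℂ} (hl : B < ‖l‖)
    (hl2 : l ≠ 1 / 2) : C.ShiftInvertible l := by
  have hK : ∀ φ t, C.Kstar φ (C.γ t) = kernelOp μ (fun t s ↦ a t s + q t) (φ ∘ C.γ) t :=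
    Kstar_comp_eq hγ hσ hker
  have hLp : ∀ φ : ℂ → ℂ, MemLp φ 2 C.σ ↔ MemLp (φ ∘ C.γ) 2 μ := fun φ ↦ by
    rw [hσ, hγ.memLp_map_measure_iff]
  have hae : ∀ p : ℂ → Prop, (∀ᵐ x ∂C.σ, p x) ↔ ∀ᵐ t ∂μ, p (C.γ t) := fun p ↦ by
    rw [hσ, hγ.ae_map_iff]
  refine ⟨fun φ hφ ↦ ?_, fun φ hφ ↦ ?_, fun φ ψ hφ hψ h ↦ ?_, fun g hg ↦ ?_⟩
  · rw [hae]
    filter_upwards [ha.kernelOp_add (q := q) inferInstance ((hLp φ).1 hφ)] with t ht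
    rw [hσ, hγ.integrable_map_iff]
    refine ht.1.congr ?_
    filter_upwards [compl_mem_ae_iff.2 (measure_singleton t)] with s hs
    simp only [Function.comp_apply]
    rw [hker t s (fun h ↦ hs h.symm)]
  · rw [hLp] at hφ ⊢
    have hqc : MemLp (fun t ↦ (q t : ℂ)) 2 μ := hq.ofReal
    refine MemLp.ae_eq ?_ ((ha.memLp_kernelOp hφ).add (hqc.mul_const (∫ s, (φ ∘ C.γ) s ∂μ)))
    filter_upwards [ha.kernelOp_add (q := q) inferInstance hφ] with t ht
    rw [Function.comp_apply, hK, ht.2]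
    rfl
  · have hφ' := (hLp φ).1 hφ
    have hψ' := (hLp ψ).1 hψ
    have h1 := (hae _).1 h
    have h2 := ha.eq_zero_add h0 hq hq1 hl hl2 (hφ'.sub hψ') (by
      filter_upwards [h1, ha.kernelOp_add (q := q) inferInstance hφ',
        ha.kernelOp_add (q := q) inferInstance hψ'] with t ht e1 e2
      simp only [shift, hK] at ht
      have e3 : kernelOp μ (fun t s ↦ a t s + q t) (φ ∘ C.γ - ψ ∘ C.γ) t =
          kernelOp μ (fun t s ↦ a t s + q t) (φ ∘ C.γ) t -
            kernelOp μ (fun t s ↦ a t s + q t) (ψ ∘ C.γ) t := by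
        simp only [kernelOp, Pi.sub_apply, mul_sub]
        exact integral_sub e1.1 e2.1
      rw [e3]
      simp only [Pi.sub_apply, Function.comp_apply]
      linear_combination ht)
    refine (hae _).2 ?_
    filter_upwards [h2] with t ht
    exact sub_eq_zero.1 ht
  · obtain ⟨f, hf, hfe⟩ := ha.exists_eq_add h0 hq hq1 hl hl2 ((hLp g).1 hg)
    have hcomp : Function.extend C.γ f 0 ∘ C.γ = f := funext fun t ↦
      hγ.injective.extend_apply f 0 t
    refine ⟨Function.extend C.γ f 0, (hLp _).2 (by rwa [hcomp]), (hae _).2 ?_⟩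
    filter_upwards [hfe] with t ht
    rw [shift, hK, hcomp, hγ.injective.extend_apply, ht]
    rfl

theorem ShiftInvertible.shiftInv_spec {l : ℂ} (h : C.ShiftInvertible l) {g : ℂ → ℂ}
    (hg : MemLp g 2 C.σ) :
    MemLp (C.shiftInv l g) 2 C.σ ∧ C.shift l (C.shiftInv l g) =ᵐ[C.σ] g := by
  have hex := h.surjective g hg
  rw [shiftInv, dif_pos hex]
  exact hex.choose_spec

/-- Linearity of the inverse, for the chosen representatives. -/
theorem ShiftInvertible.ae_eq_shiftInv_add {l : ℂ} (h : C.ShiftInvertible l) {φ g₁ g₂ : ℂ → ℂ}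
    (hφ : MemLp φ 2 C.σ) (h₁ : MemLp g₁ 2 C.σ) (h₂ : MemLp g₂ 2 C.σ)
    (he : C.shift l φ =ᵐ[C.σ] g₁ + g₂) : φ =ᵐ[C.σ] C.shiftInv l g₁ + C.shiftInv l g₂ := by
  obtain ⟨m₁, e₁⟩ := h.shiftInv_spec h₁
  obtain ⟨m₂, e₂⟩ := h.shiftInv_spec h₂
  refine h.injective _ _ hφ (m₁.add m₂) ?_
  filter_upwards [he, e₁, e₂, h.integrable _ m₁, h.integrable _ m₂] with x hx h1 h2 i1 i2
  have : C.Kstar (C.shiftInv l g₁ + C.shiftInv l g₂) x =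
      C.Kstar (C.shiftInv l g₁) x + C.Kstar (C.shiftInv l g₂) x := by
    simp only [Kstar, Pi.add_apply, mul_add]
    exact integral_add i1 i2
  rw [hx, shift, this, Pi.add_apply, Pi.add_apply, ← h1, ← h2, shift, shift]
  ring

theorem measurable_normalAt (hC : ContDiff ℝ 1 C.γ) : Measurable C.normalAt := by
  have : Measurable (deriv C.γ) := hC.continuous_deriv_one.measurable
  unfold normalAt
  fun_prop

theorem norm_normalAt_le (t : ℝ) : ‖C.normalAt t‖ ≤ 1 := by
  rw [normalAt, norm_div, norm_mul, norm_neg, Complex.norm_I, one_mul, Complex.norm_real,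
    norm_norm]
  exact div_self_le_one _

/-- The normal derivative of a function whose differential is bounded on the curve is square
integrable. -/
theorem memLp_dn {μ : Measure ℝ} [IsFiniteMeasure μ] (hγ : MeasurableEmbedding C.γ)
    (hC : ContDiff ℝ 1 C.γ) (hσ : C.σ = Measure.map C.γ μ)
    (hν : ∀ t, C.ν (C.γ t) = C.normalAt t) {f : ℂ → ℂ} {B : ℝ}
    (hf : ∀ t, ‖fderiv ℝ f (C.γ t)‖ ≤ B) : MemLp (C.dn f) 2 C.σ := by
  rw [hσ, hγ.memLp_map_measure_iff]
  have hfun : C.dn f ∘ C.γ = fun t ↦ fderiv ℝ f (C.γ t) (C.normalAt t) := by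
    ext t; simp only [dn, Function.comp_apply, hν]
  rw [hfun]
  have h1 : StronglyMeasurable fun t ↦ fderiv ℝ f (C.γ t) :=
    ((measurable_fderiv ℝ f).comp hγ.measurable).stronglyMeasurable
  have h2 : StronglyMeasurable C.normalAt := (measurable_normalAt hC).stronglyMeasurable
  refine MemLp.of_bound (C := B)
    (isBoundedBilinearMap_apply.continuous.comp_stronglyMeasurable
      (h1.prodMk h2)).aestronglyMeasurable (Eventually.of_forall fun t ↦ ?_)
  exact ((fderiv ℝ f (C.γ t)).le_opNorm _).trans
    ((mul_le_of_le_one_right (norm_nonneg _) (norm_normalAt_le t)).trans (hf t))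

end Curve

/-- The parameter `λ` of a contrast of positive permittivities lies outside `[-1/2, 1/2]`. -/
theorem norm_contrast {εm εp : ℝ} (hm : 0 < εm) (hp : 0 < εp) (hne : εm ≠ εp) :
    1 / 2 < ‖contrast εm εp‖ := by
  have h : contrast εm εp = (((εm + εp) / (2 * (εm - εp)) : ℝ) : ℂ) := by
    rw [contrast]; push_cast; rfl
  have h0 : 0 < |εm - εp| := abs_pos.2 (sub_ne_zero.2 hne)
  rw [h, Complex.norm_real, Real.norm_eq_abs, abs_div, abs_mul,
    abs_of_pos (by linarith : 0 < εm + εp),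
    abs_of_pos (by norm_num : (0 : ℝ) < 2), div_lt_div_iff₀ (by norm_num) (by positivity)]
  have : |εm - εp| < εm + εp := by rw [abs_lt]; constructor <;> linarith
  linarith

section FirstBoundary

variable {d r δ : ℝ} {h₀ : ℝ → ℝ} {R M K η : ℝ}

theorem bdry₁_σ : (bdry₁ d r h₀ δ).σ =
    Measure.map (bdry₁ d r h₀ δ).γ (densityMeasure fun t ↦ ‖deriv (bdry₁ d r h₀ δ).γ t‖) := by
  rw [Curve.σ, densityMeasure]
  simp [bdry₁]

theorem bdry₁_γ (t : ℝ) :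
    (bdry₁ d r h₀ δ).γ t = Phi d r (graphPt (fun u ↦ δ * h₀ (-u)) t) := rfl

theorem abs_scaled_le (hk : HolderBump (fun t ↦ h₀ (-t)) R M K η) (hδ : 0 ≤ δ) {m : ℝ}
    (hM : δ * M ≤ m) (t : ℝ) : |δ * h₀ (-t)| ≤ m := by
  rw [abs_mul, abs_of_nonneg hδ]
  exact (mul_le_mul_of_nonneg_left (hk.abs_le t) hδ).trans hM

theorem differentiable_scaled (hk : HolderBump (fun t ↦ h₀ (-t)) R M K η) :
    Differentiable ℝ fun u ↦ δ * h₀ (-u) := hk.differentiable.const_mul δ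

theorem scaled_lt (hk : HolderBump (fun t ↦ h₀ (-t)) R M K η) (hδ : 0 ≤ δ) {c : ℝ} (hc : 0 < c)
    (hM : δ * M ≤ c / 2) (t : ℝ) : δ * h₀ (-t) < c :=
  ((le_abs_self _).trans (abs_scaled_le hk hδ hM t)).trans_lt (half_lt_self hc)

theorem bdry₁_injective (hk : HolderBump (fun t ↦ h₀ (-t)) R M K η) (hδ : 0 ≤ δ)
    (hc : 0 < focus d r) (hM : δ * M ≤ focus d r / 2) :
    Function.Injective (bdry₁ d r h₀ δ).γ :=
  injective_Phi_graphPt hc (scaled_lt hk hδ hc hM)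

theorem bdry₁_contDiff (hk : HolderBump (fun t ↦ h₀ (-t)) R M K η) (hδ : 0 ≤ δ)
    (hc : 0 < focus d r) (hM : δ * M ≤ focus d r / 2) :
    ContDiff ℝ 1 (bdry₁ d r h₀ δ).γ :=
  contDiff_Phi_graphPt (contDiff_const.mul hk.contDiff) (scaled_lt hk hδ hc hM)

theorem bdry₁_measurableEmbedding (hk : HolderBump (fun t ↦ h₀ (-t)) R M K η) (hδ : 0 ≤ δ)
    (hc : 0 < focus d r) (hM : δ * M ≤ focus d r / 2) :
    MeasurableEmbedding (bdry₁ d r h₀ δ).γ :=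
  (bdry₁_contDiff hk hδ hc hM).continuous.measurableEmbedding (bdry₁_injective hk hδ hc hM)

theorem bdry₁_ν (hk : HolderBump (fun t ↦ h₀ (-t)) R M K η) (hδ : 0 ≤ δ)
    (hc : 0 < focus d r) (hM : δ * M ≤ focus d r / 2) (t : ℝ) :
    (bdry₁ d r h₀ δ).ν ((bdry₁ d r h₀ δ).γ t) = (bdry₁ d r h₀ δ).normalAt t := by
  have hinj := bdry₁_injective hk hδ hc hM
  rw [Curve.ν]
  congr 1
  exact hinj (Function.invFunOn_eq ⟨t, Set.mem_univ t, rfl⟩)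

theorem isFiniteMeasure_densityMeasure {ρ : ℝ → ℝ} {hi : ℝ} (hρ : Measurable ρ)
    (hpos : ∀ t, 0 ≤ ρ t) (hle : ∀ t, ρ t ≤ hi * (1 + t ^ 2)⁻¹) :
    IsFiniteMeasure (densityMeasure ρ) := by
  refine isFiniteMeasure_withDensity_ofReal ?_
  refine ((integrable_inv_one_add_sq.const_mul hi).mono' hρ.aestronglyMeasurable
    (Eventually.of_forall fun t ↦ ?_)).2
  rw [Real.norm_of_nonneg (hpos t)]
  exact hle t

theorem bdry₁_abs_deriv_le (hk : HolderBump (fun t ↦ h₀ (-t)) R M K η) (hδ : 0 ≤ δ) (hδ1 : δ ≤ 1)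
    (t : ℝ) : |deriv (fun u ↦ δ * h₀ (-u)) t| ≤ M := by
  rw [deriv_const_mul_field', abs_mul, abs_of_nonneg hδ]
  exact (mul_le_of_le_one_left (abs_nonneg _) hδ1).trans (hk.abs_deriv_le t)

theorem bdry₁_speed_bounds (hk : HolderBump (fun t ↦ h₀ (-t)) R M K η) (hδ : 0 ≤ δ)
    (hδ1 : δ ≤ 1) (hc : 0 < focus d r) (hM : δ * M ≤ focus d r / 2) (t : ℝ) :
    2 * focus d r / (1 + 9 * focus d r ^ 2 / 4) * (1 + t ^ 2)⁻¹ ≤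
      ‖deriv (bdry₁ d r h₀ δ).γ t‖ ∧
    ‖deriv (bdry₁ d r h₀ δ).γ t‖ ≤
      2 * focus d r * (1 + M) * (1 + 4 / focus d r ^ 2) * (1 + t ^ 2)⁻¹ :=
  ⟨le_norm_deriv_Phi_graphPt (differentiable_scaled hk) hc (abs_scaled_le hk hδ hM) t,
    norm_deriv_Phi_graphPt_le (differentiable_scaled hk) hc (abs_scaled_le hk hδ hM)
      (bdry₁_abs_deriv_le hk hδ hδ1) t⟩

theorem bdry₁_measurable_speed (hk : HolderBump (fun t ↦ h₀ (-t)) R M K η) (hδ : 0 ≤ δ)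
    (hc : 0 < focus d r) (hM : δ * M ≤ focus d r / 2) :
    Measurable fun t ↦ ‖deriv (bdry₁ d r h₀ δ).γ t‖ :=
  (bdry₁_contDiff hk hδ hc hM).continuous_deriv_one.norm.measurable

theorem bdry₁_isFiniteMeasure (hk : HolderBump (fun t ↦ h₀ (-t)) R M K η) (hδ : 0 ≤ δ)
    (hδ1 : δ ≤ 1) (hc : 0 < focus d r) (hM : δ * M ≤ focus d r / 2) :
    IsFiniteMeasure (densityMeasure fun t ↦ ‖deriv (bdry₁ d r h₀ δ).γ t‖) :=
  isFiniteMeasure_densityMeasure (bdry₁_measurable_speed hk hδ hc hM) (fun _ ↦ norm_nonneg _)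
    fun t ↦ (bdry₁_speed_bounds hk hδ hδ1 hc hM t).2

theorem bdry₁_npKernel (hk : HolderBump (fun t ↦ h₀ (-t)) R M K η) (hδ : 0 ≤ δ)
    (hc : 0 < focus d r) (hM : δ * M ≤ focus d r / 2) {t s : ℝ} (hts : t ≠ s) :
    (bdry₁ d r h₀ δ).npKernel ((bdry₁ d r h₀ δ).γ t) ((bdry₁ d r h₀ δ).γ s) =
      graphKernel (fun u ↦ δ * h₀ (-u)) t s / ‖deriv (bdry₁ d r h₀ δ).γ t‖ +
      poleKernel (fun u ↦ δ * h₀ (-u)) (focus d r) t / ‖deriv (bdry₁ d r h₀ δ).γ t‖ := by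
  have hne : (bdry₁ d r h₀ δ).γ t ≠ (bdry₁ d r h₀ δ).γ s :=
    (bdry₁_injective hk hδ hc hM).ne hts
  rw [Curve.npKernel_eq _ hne, bdry₁_ν hk hδ hc hM, ← add_div,
    ← kernel_Phi_graphPt (differentiable_scaled hk) hc (scaled_lt hk hδ hc hM) hts, Curve.normalAt,
    div_right_comm, Complex.div_ofReal_re]
  exact (mul_div_assoc _ _ _).symm

theorem bdry₁_shiftInvertible (hk : HolderBump (fun t ↦ h₀ (-t)) R M K η) {δ B : ℝ≥0}
    (hδ1 : (δ : ℝ) ≤ 1) (hc : 0 < focus d r) (hM : δ * M ≤ focus d r / 2)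
    (hB : ∀ ρ : ℝ → ℝ, Measurable ρ →
      (∀ t, 2 * focus d r / (1 + 9 * focus d r ^ 2 / 4) * (1 + t ^ 2)⁻¹ ≤ ρ t) →
      (∀ t, ρ t ≤ 2 * focus d r * (1 + M) * (1 + 4 / focus d r ^ 2) * (1 + t ^ 2)⁻¹) →
      IsSchurKernel (densityMeasure ρ) (fun t s ↦ graphKernel (fun u ↦ δ * h₀ (-u)) t s / ρ t) B)
    {l : ℂ} (hl : B < ‖l‖) (hl2 : l ≠ 1 / 2) : (bdry₁ d r h₀ δ).ShiftInvertible l := by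
  have hδ : (0 : ℝ) ≤ δ := δ.coe_nonneg
  set ρ : ℝ → ℝ := fun t ↦ ‖deriv (bdry₁ d r h₀ δ).γ t‖ with hρdef
  have hρm : Measurable ρ := bdry₁_measurable_speed hk hδ hc hM
  have hρ := bdry₁_speed_bounds hk hδ hδ1 hc hM
  have hlo : 0 < 2 * focus d r / (1 + 9 * focus d r ^ 2 / 4) := by positivity
  have hpos : ∀ t, 0 < ρ t := fun t ↦ lt_of_lt_of_le (by positivity) (hρ t).1
  have := bdry₁_isFiniteMeasure hk hδ hδ1 hc hM
  have : NullSingletonClass (densityMeasure ρ) := by unfold densityMeasure; infer_instance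
  have hcd : ContDiff ℝ 1 fun u ↦ δ * h₀ (-u) := contDiff_const.mul hk.contDiff
  have hcancel : ∀ (f : ℝ → ℝ), ∫ t, f t / ρ t ∂densityMeasure ρ = ∫ t, f t := fun f ↦ by
    rw [integral_densityMeasure hρm fun t ↦ (hpos t).le]
    refine integral_congr_ae (Eventually.of_forall fun t ↦ ?_)
    exact mul_div_cancel₀ _ (hpos t).ne'
  refine Curve.shiftInvertible_of_isSchurKernel (bdry₁_measurableEmbedding hk hδ hc hM) bdry₁_σ
    (hB ρ hρm (fun t ↦ (hρ t).1) fun t ↦ (hρ t).2) (fun s ↦ ?_)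
    (q := fun t ↦ poleKernel (fun u ↦ δ * h₀ (-u)) (focus d r) t / ρ t) ?_ ?_
    (fun t s hts ↦ bdry₁_npKernel hk hδ hc hM hts) hl hl2
  · rw [hcancel fun t ↦ graphKernel (fun u ↦ δ * h₀ (-u)) t s]
    exact hk.integral_graphKernel hδ s
  · refine MemLp.of_bound ((measurable_poleKernel hcd _).div hρm).aestronglyMeasurable
      ((M * R + 2 * focus d r) * (1 + 4 / focus d r ^ 2) /
        (2 * focus d r / (1 + 9 * focus d r ^ 2 / 4))) (Eventually.of_forall fun t ↦ ?_)
    rw [Real.norm_eq_abs, abs_div, abs_of_pos (hpos t), div_le_div_iff₀ (hpos t) hlo]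
    have h1 := hk.abs_poleKernel_le hδ hδ1 hc hM t
    have hM0 := hk.bound_nonneg
    have hR := hk.radius_pos
    calc _ ≤ _ := mul_le_mul_of_nonneg_right h1 hlo.le
      _ = (M * R + 2 * focus d r) * (1 + 4 / focus d r ^ 2) *
          (2 * focus d r / (1 + 9 * focus d r ^ 2 / 4) * (1 + t ^ 2)⁻¹) := by ring
      _ ≤ _ := mul_le_mul_of_nonneg_left (hρ t).1 (by positivity)
  · rw [hcancel]
    exact hk.integral_poleKernel hδ hδ1 hc hM

end FirstBoundary

end Plasmon

/-! ### The two boundaries -/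

namespace Plasmon

section FirstBoundary

variable {d r δ : ℝ} {h₀ : ℝ → ℝ} {R M K η : ℝ}

theorem sub_ne_zero_of_mem_halfPlane (hg : δ * h₀ 0 < focus d r) {z : ℂ}
    (hz : z ∈ halfPlane h₀ δ) : z - Complex.I * focus d r ≠ 0 := by
  intro h
  have h1 : z = Complex.I * focus d r := sub_eq_zero.1 h
  rw [halfPlane, Set.mem_ofPred_eq, h1] at hz
  simp at hz
  linarith

theorem mem_D₁_iff (hc : 0 < focus d r) (hg : δ * h₀ 0 < focus d r) {w : ℂ} :
    w ∈ D₁ d r h₀ δ ↔ w ≠ 1 ∧ PhiInv d r w ∈ halfPlane h₀ δ := by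
  constructor
  · rintro ⟨z, hz, rfl⟩
    refine ⟨Phi_ne_one hc z, ?_⟩
    rwa [PhiInv_Phi hc (sub_ne_zero_of_mem_halfPlane hg hz)]
  · rintro ⟨h1, h2⟩
    exact ⟨_, h2, Phi_PhiInv hc h1⟩

/-- The outward condition is checked with `F = Im Φ⁻¹ - g(-Re Φ⁻¹)`, which is negative on `D₁`: its
derivative along the normal is positive. -/
theorem isBoundaryOf_bdry₁ (hh : ContDiff ℝ 1 h₀)
    (hk : HolderBump (fun t ↦ h₀ (-t)) R M K η) (hδ : 0 ≤ δ)
    (hc : 0 < focus d r) (hM : δ * M ≤ focus d r / 2) :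
    (bdry₁ d r h₀ δ).IsBoundaryOf (D₁ d r h₀ δ) := by
  set g : ℝ → ℝ := fun u ↦ δ * h₀ (-u) with hgdef
  have hgd : Differentiable ℝ g := differentiable_scaled hk
  have hgc : ∀ t, g t < focus d r := scaled_lt hk hδ hc hM
  have hg0 : δ * h₀ 0 < focus d r := by simpa [hgdef] using hgc 0
  have hγ : ∀ t, (bdry₁ d r h₀ δ).γ t = Phi d r (graphPt g t) := bdry₁_γ
  have hder : ∀ t, deriv (bdry₁ d r h₀ δ).γ t ≠ 0 := deriv_Phi_graphPt_ne_zero hgd hc hgc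
  have hinv : ∀ t, PhiInv d r ((bdry₁ d r h₀ δ).γ t) = graphPt g t := fun t ↦ by
    rw [hγ, PhiInv_Phi hc (graphPt_sub_ne_zero hgc t)]
  have hout : ∀ t, ∀ᶠ τ : ℝ in 𝓝[>] 0,
      (bdry₁ d r h₀ δ).γ t - τ * (bdry₁ d r h₀ δ).normalAt t ∈ D₁ d r h₀ δ ∧
      (bdry₁ d r h₀ δ).γ t + τ * (bdry₁ d r h₀ δ).normalAt t ∉ D₁ d r h₀ δ := by
    intro t
    set n := (bdry₁ d r h₀ δ).normalAt t with hn
    set x := (bdry₁ d r h₀ δ).γ t with hx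
    set ρ := ‖deriv (bdry₁ d r h₀ δ).γ t‖ with hρ
    have hρ0 : 0 < ρ := norm_pos_iff.2 (hder t)
    have hx1 : x ≠ 1 := Phi_ne_one hc _
    have hsub := graphPt_sub_ne_zero hgc t
    set L : ℝ → ℂ := fun τ ↦ x + τ * n with hL
    have hL0 : L 0 = x := by simp [hL]
    have hLd : HasDerivAt L n 0 :=
      (((hasDerivAt_id (0 : ℝ)).ofReal_comp.mul_const n).const_add x).congr_deriv (by simp)
    -- the preimage of the normal line starts in the direction of the upward normal of the graph
    have hΨ : HasDerivAt (fun τ ↦ PhiInv d r (L τ)) ((deriv g t + Complex.I) / ρ) 0 := by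
      have h1 : HasDerivAt (PhiInv d r) (-2 * (Complex.I * focus d r) / (x - 1) ^ 2) (L 0) := by
        rw [hL0]; exact hasDerivAt_PhiInv hx1
      have h2 := h1.comp (0 : ℝ) hLd
      refine h2.congr_deriv ?_
      have hfc : (focus d r : ℂ) ≠ 0 := by exact_mod_cast hc.ne'
      have hρc : (ρ : ℂ) ≠ 0 := by exact_mod_cast hρ0.ne'
      have h3 : x - 1 = 2 * (Complex.I * focus d r) / (graphPt g t - Complex.I * focus d r) := by
        rw [hx, hγ, Phi_sub_one hsub]
      have h4 : deriv (bdry₁ d r h₀ δ).γ t = _ := (hasDerivAt_Phi_graphPt hgd hgc t).deriv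
      have h5 : -Complex.I * (-1 + (deriv g t : ℝ) * Complex.I) = (deriv g t : ℝ) + Complex.I := by
        linear_combination (-((deriv g t : ℝ) : ℂ)) * Complex.I_mul_I
      rw [hn, Curve.normalAt, ← hρ, h3, h4, ← h5]
      field_simp
    have hre : HasDerivAt (fun τ ↦ (PhiInv d r (L τ)).re) (deriv g t / ρ) 0 := by
      have := Complex.reCLM.hasFDerivAt.comp_hasDerivAt (0 : ℝ) hΨ
      refine this.congr_deriv ?_
      simp [Complex.div_ofReal_re]
    have him : HasDerivAt (fun τ ↦ (PhiInv d r (L τ)).im) (1 / ρ) 0 := by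
      have := Complex.imCLM.hasFDerivAt.comp_hasDerivAt (0 : ℝ) hΨ
      refine this.congr_deriv ?_
      simp [Complex.div_ofReal_im]
    set F : ℝ → ℝ := fun τ ↦ (PhiInv d r (L τ)).im - g (-(PhiInv d r (L τ)).re) with hF
    have hΨ0 : PhiInv d r (L 0) = graphPt g t := by rw [hL0]; exact hinv t
    have hF0 : F 0 = 0 := by
      simp only [hF, hΨ0, graphPt_re, graphPt_im, neg_neg, sub_self]
    have hFd : HasDerivAt F (1 / ρ + deriv g t * (deriv g t / ρ)) 0 := by
      have h1 : HasDerivAt g (deriv g t) (-(PhiInv d r (L 0)).re) := by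
        rw [hΨ0, graphPt_re, neg_neg]; exact (hgd t).hasDerivAt
      refine (him.sub (h1.comp (0 : ℝ) hre.neg)).congr_deriv ?_
      ring
    have hFpos : 0 < deriv F 0 := by
      rw [hFd.deriv]
      have : 0 ≤ deriv g t * (deriv g t / ρ) := by
        rw [← mul_div_assoc]; exact div_nonneg (mul_self_nonneg _) hρ0.le
      positivity
    have hsign := eventually_nhdsWithin_sign_eq_of_deriv_pos hFpos hF0
    have hne : ∀ᶠ τ in 𝓝 (0 : ℝ), L τ ≠ 1 :=
      hLd.continuousAt.eventually_ne (by rwa [hL0])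
    have hmem : ∀ τ, L τ ≠ 1 → (L τ ∈ D₁ d r h₀ δ ↔ F τ < 0) := fun τ h ↦ by
      rw [mem_D₁_iff hc hg0, and_iff_right h, halfPlane, Set.mem_ofPred_eq, hF, hgdef]
      simp only [neg_neg, sub_neg]
    have hall := hsign.and hne
    have hneg : Tendsto (fun τ : ℝ ↦ -τ) (𝓝 0) (𝓝 0) := by
      simpa using (continuous_neg (G := ℝ)).tendsto 0
    filter_upwards [nhdsWithin_le_nhds hall, nhdsWithin_le_nhds (hneg.eventually hall),
      self_mem_nhdsWithin] with τ h1 h2 hτ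
    have hτ' : 0 < τ := hτ
    constructor
    · have : x - τ * n = L (-τ) := by simp [hL]; ring
      rw [this, hmem _ h2.2, ← sign_eq_neg_one_iff, h2.1, sub_zero, sign_eq_neg_one_iff]
      linarith
    · change L τ ∉ _
      rw [hmem _ h1.2, not_lt]
      refine le_of_lt ?_
      rw [← sign_eq_one_iff, h1.1, sub_zero, sign_eq_one_iff]
      exact hτ'
  refine ⟨(bdry₁_injective hk hδ hc hM).injOn, bdry₁_contDiff hk hδ hc hM, hder, ?_, ?_,
    fun t _ ↦ hout t⟩
  · rintro _ ⟨t, -, rfl⟩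
    have htend : ∀ s : ℝ, Tendsto (fun τ : ℝ ↦ (bdry₁ d r h₀ δ).γ t +
        s * τ * (bdry₁ d r h₀ δ).normalAt t) (𝓝[>] 0) (𝓝 ((bdry₁ d r h₀ δ).γ t)) := fun s ↦ by
      have : Continuous fun τ : ℝ ↦ (bdry₁ d r h₀ δ).γ t +
        s * τ * (bdry₁ d r h₀ δ).normalAt t := by fun_prop
      have h := this.tendsto 0
      simp only [Complex.ofReal_zero, mul_zero, zero_mul, add_zero] at h
      exact h.mono_left nhdsWithin_le_nhds
    rw [frontier_eq_closure_inter_closure]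
    refine ⟨mem_closure_of_tendsto (htend (-1)) ?_, mem_closure_of_tendsto (htend 1) ?_⟩
    · filter_upwards [hout t] with τ h
      convert h.1 using 1
      push_cast
      ring
    · filter_upwards [hout t] with τ h
      have := h.2
      rw [Set.mem_compl_iff]
      convert this using 2
      push_cast
      ring
  · refine (Set.finite_singleton (1 : ℂ)).subset ?_
    rintro w ⟨hw, hw2⟩
    by_contra hw1
    have hw1 : w ≠ 1 := hw1
    have hcont : ContinuousAt (PhiInv d r) w := (hasDerivAt_PhiInv hw1).continuousAt
    have hnear : ∀ᶠ v in 𝓝 w, v ≠ 1 := isOpen_ne.mem_nhds hw1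
    have hH : Continuous fun z : ℂ ↦ δ * h₀ z.re :=
      continuous_const.mul (hh.continuous.comp Complex.continuous_re)
    rcases lt_trichotomy (PhiInv d r w).im (δ * h₀ (PhiInv d r w).re) with h | h | h
    · have hev := hcont.eventually ((isOpen_lt Complex.continuous_im hH).mem_nhds h)
      have : D₁ d r h₀ δ ∈ 𝓝 w := by
        filter_upwards [hev, hnear] with v h1 h2
        exact (mem_D₁_iff hc hg0).2 ⟨h2, h1⟩
      exact hw.2 (mem_interior_iff_mem_nhds.2 this)
    · refine hw2 ⟨-(PhiInv d r w).re, Set.mem_univ _, ?_⟩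
      have : graphPt g (-(PhiInv d r w).re) = PhiInv d r w := by
        apply Complex.ext
        · rw [graphPt_re, neg_neg]
        · rw [graphPt_im, h, hgdef]; simp
      rw [hγ, this, Phi_PhiInv hc hw1]
    · have hev := hcont.eventually ((isOpen_lt hH Complex.continuous_im).mem_nhds h)
      have : (D₁ d r h₀ δ)ᶜ ∈ 𝓝 w := by
        filter_upwards [hev] with v h1 h2
        exact absurd ((mem_D₁_iff hc hg0).1 h2).2 (not_lt.2 (le_of_lt h1))
      rw [frontier_eq_closure_inter_closure] at hw
      exact (mem_closure_iff_nhds.1 hw.1 _ this).elim fun v hv ↦ hv.1 hv.2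

/-- A compact set containing the image under `Φ` of the points of height at most `m`, when `m` is
small.  The inequality says that `Im Φ⁻¹(w) ≤ m`, written without denominators so that `w = 1` is
included. -/
def collar (d r m : ℝ) : Set ℂ :=
  Metric.closedBall 0 5 ∩ {w | focus d r * (‖w‖ ^ 2 - 1) ≤ m * ‖w - 1‖ ^ 2}

theorem isCompact_collar (d r m : ℝ) : IsCompact (collar d r m) := by
  refine (isCompact_closedBall _ _).inter_right (isClosed_le ?_ ?_) <;> fun_prop

theorem Phi_mem_collar (hc : 0 < focus d r) {z : ℂ} {m : ℝ} (hz : z.im ≤ m)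
    (hz2 : z.im ≤ focus d r / 2) : Phi d r z ∈ collar d r m := by
  have hn : Complex.normSq (z - Complex.I * focus d r) = z.re ^ 2 + (z.im - focus d r) ^ 2 := by
    rw [Complex.normSq_apply]; simp; ring
  have hn2 : Complex.normSq (z + Complex.I * focus d r) = z.re ^ 2 + (z.im + focus d r) ^ 2 := by
    rw [Complex.normSq_apply]; simp; ring
  have hpos : 0 < z.re ^ 2 + (z.im - focus d r) ^ 2 := by nlinarith [sq_nonneg z.re]
  have hsub : z - Complex.I * focus d r ≠ 0 := by
    rw [← Complex.normSq_pos, hn]; exact hpos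
  have h1 : ‖Phi d r z - 1‖ ^ 2 = 4 * focus d r ^ 2 / (z.re ^ 2 + (z.im - focus d r) ^ 2) := by
    rw [Phi_sub_one hsub, norm_div, div_pow, ← Complex.normSq_eq_norm_sq (z - _), hn]
    congr 1
    simp only [norm_mul, Complex.norm_ofNat, Complex.norm_I, one_mul, Complex.norm_real,
      Real.norm_eq_abs, mul_pow, sq_abs]
    norm_num
  refine ⟨?_, ?_⟩
  · rw [mem_closedBall_zero_iff]
    have h2 : ‖Phi d r z - 1‖ ≤ 4 := by
      refine le_of_sq_le_sq ?_ (by norm_num)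
      rw [h1, div_le_iff₀ hpos]
      nlinarith [sq_nonneg z.re]
    calc ‖Phi d r z‖ = ‖(Phi d r z - 1) + 1‖ := by rw [sub_add_cancel]
      _ ≤ ‖Phi d r z - 1‖ + ‖(1 : ℂ)‖ := norm_add_le _ _
      _ ≤ 5 := by rw [norm_one]; linarith
  · have h3 : ‖Phi d r z‖ ^ 2 - 1 =
        4 * focus d r * z.im / (z.re ^ 2 + (z.im - focus d r) ^ 2) := by
      rw [Phi, norm_div, div_pow, ← Complex.normSq_eq_norm_sq, ← Complex.normSq_eq_norm_sq, hn, hn2]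
      field_simp
      ring
    rw [Set.mem_ofPred_eq, h1, h3, ← mul_div_assoc, ← mul_div_assoc]
    gcongr ?_ / _
    nlinarith [mul_pos hc hc]

theorem bdry₁_mem_collar (hk : HolderBump (fun t ↦ h₀ (-t)) R M K η) (hδ : 0 ≤ δ) {m : ℝ}
    (hc : 0 < focus d r) (hM : δ * M ≤ focus d r / 2) (hm : δ * M ≤ m) (t : ℝ) :
    (bdry₁ d r h₀ δ).γ t ∈ collar d r m := by
  rw [bdry₁_γ]
  refine Phi_mem_collar hc ?_ ?_ <;> rw [graphPt_im]
  · exact (le_abs_self _).trans (abs_scaled_le hk hδ hm t)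
  · exact (le_abs_self _).trans (abs_scaled_le hk hδ hM t)

end FirstBoundary

section SecondBoundary

variable {d r : ℝ}

theorem exp_sPar (hr : 0 < r) (hd : r < d) : Real.exp (sPar d r) = (focus d r + d) / r := by
  have hd0 : 0 < d := hr.trans hd
  have h1 : 0 ≤ (d / r) ^ 2 - 1 := by
    rw [div_pow, sub_nonneg, one_le_div (by positivity)]
    nlinarith
  have h2 : Real.sqrt ((d / r) ^ 2 - 1) = focus d r / r := by
    have h3 : (d / r) ^ 2 - 1 = (d ^ 2 - r ^ 2) / r ^ 2 := by field_simp
    rw [focus, h3, Real.sqrt_div' _ (by positivity), Real.sqrt_sq hr.le]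
  rw [sPar, Real.exp_arsinh, Real.sq_sqrt h1, add_sub_cancel, Real.sqrt_sq (by positivity), h2]
  ring

theorem one_lt_exp_sPar (hr : 0 < r) (hd : r < d) : 1 < Real.exp (sPar d r) := by
  rw [exp_sPar hr hd, one_lt_div hr]
  linarith [focus_pos hr hd]

/-- The height of `Φ⁻¹(-e^s)` is `d - r`, the lowest point of the particle. -/
theorem focus_mul_exp_sub_one (hr : 0 < r) (hd : r < d) :
    focus d r * (Real.exp (sPar d r) - 1) = (d - r) * (Real.exp (sPar d r) + 1) := by
  have := focus_sq hr hd
  rw [exp_sPar hr hd]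
  field_simp
  linear_combination this

theorem disjoint_sphere_collar (hr : 0 < r) (hd : r < d) {m : ℝ} (hm0 : 0 ≤ m) (hm : m < d - r) :
    Disjoint (Metric.sphere (0 : ℂ) (Real.exp (sPar d r))) (collar d r m) := by
  rw [Set.disjoint_left]
  rintro w hw ⟨-, hw2⟩
  rw [mem_sphere_zero_iff_norm] at hw
  rw [Set.mem_ofPred_eq, hw] at hw2
  have h1 : ‖w - 1‖ ≤ Real.exp (sPar d r) + 1 := by
    simpa [hw] using norm_sub_le w 1
  have h2 := focus_mul_exp_sub_one hr hd
  set E := Real.exp (sPar d r)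
  have hE : 0 < E := Real.exp_pos _
  have h3 : m * ‖w - 1‖ ^ 2 ≤ m * (E + 1) ^ 2 := by gcongr
  have h4 : focus d r * (E ^ 2 - 1) = (d - r) * (E + 1) ^ 2 := by
    linear_combination (E + 1) * h2
  have h5 : m * (E + 1) ^ 2 < (d - r) * (E + 1) ^ 2 := by gcongr
  linarith

theorem D₂_eq_ball (hr : 0 < r) (hd : r < d) :
    D₂ d r = Metric.ball 0 (Real.exp (sPar d r)) := by
  have hc := focus_pos hr hd
  have hd0 : 0 < d := hr.trans hd
  have hsq := focus_sq hr hd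
  have hcd : focus d r < d := by nlinarith
  have hE : Real.exp (sPar d r) ^ 2 * (d - focus d r) = d + focus d r := by
    rw [exp_sPar hr hd, div_pow, div_mul_eq_mul_div, div_eq_iff (by positivity)]
    linear_combination (-(d + focus d r)) * hsq
  have hcl : closure (particle d r) = Metric.closedBall (d * Complex.I) r :=
    closure_ball _ hr.ne'
  have hkey : ∀ z : ℂ, z - Complex.I * focus d r ≠ 0 →
      (‖Phi d r z‖ < Real.exp (sPar d r) ↔ z ∉ Metric.closedBall (d * Complex.I) r) := by
    intro z hz
    have hpos := Complex.normSq_pos.2 hz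
    have hn : Complex.normSq (z - Complex.I * focus d r) = z.re ^ 2 + (z.im - focus d r) ^ 2 := by
      rw [Complex.normSq_apply]; simp; ring
    have hn2 : Complex.normSq (z + Complex.I * focus d r) = z.re ^ 2 + (z.im + focus d r) ^ 2 := by
      rw [Complex.normSq_apply]; simp; ring
    have hn3 : Complex.normSq (z - d * Complex.I) = z.re ^ 2 + (z.im - d) ^ 2 := by
      rw [Complex.normSq_apply]; simp; ring
    rw [mem_closedBall_iff_norm, not_le, ← sq_lt_sq₀ (norm_nonneg _) (Real.exp_pos _).le,
      ← sq_lt_sq₀ hr.le (norm_nonneg _), Phi, norm_div, div_pow, ← Complex.normSq_eq_norm_sq,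
      ← Complex.normSq_eq_norm_sq, ← Complex.normSq_eq_norm_sq, div_lt_iff₀ hpos,
      ← mul_lt_mul_iff_right₀ (sub_pos.2 hcd), ← mul_assoc, mul_comm (d - focus d r) (_ ^ 2), hE,
      hn, hn2, hn3]
    constructor <;> intro h
    · have : 0 < 2 * focus d r * (z.re ^ 2 + (z.im - d) ^ 2 - r ^ 2) := by nlinarith
      have := (mul_pos_iff_of_pos_left (by positivity)).1 this
      linarith
    · have : 0 < 2 * focus d r * (z.re ^ 2 + (z.im - d) ^ 2 - r ^ 2) :=
        mul_pos (by positivity) (by linarith)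
      nlinarith
  have hpole : Complex.I * focus d r ∈ Metric.closedBall (d * Complex.I) r := by
    rw [mem_closedBall_iff_norm]
    have : Complex.I * focus d r - d * Complex.I = ((focus d r - d : ℝ) : ℂ) * Complex.I := by
      push_cast; ring
    rw [this, norm_mul, Complex.norm_I, mul_one, Complex.norm_real, Real.norm_eq_abs, abs_le]
    constructor <;> nlinarith
  ext w
  rw [D₂, hcl, mem_ball_zero_iff]
  constructor
  · rintro (rfl | ⟨z, hz, rfl⟩)
    · rw [norm_one]; exact one_lt_exp_sPar hr hd
    · refine (hkey z fun h ↦ hz ?_).2 hz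
      rwa [sub_eq_zero.1 h]
  · intro hw
    rcases eq_or_ne w 1 with rfl | hw1
    · exact Set.mem_insert _ _
    · refine Set.mem_insert_of_mem _ ⟨PhiInv d r w, ?_, Phi_PhiInv hc hw1⟩
      refine (hkey _ (PhiInv_sub_ne_zero hc hw1)).1 ?_
      rwa [Phi_PhiInv hc hw1]

theorem frontier_D₂ (hr : 0 < r) (hd : r < d) :
    frontier (D₂ d r) = Metric.sphere 0 (Real.exp (sPar d r)) := by
  rw [D₂_eq_ball hr hd, frontier_ball _ (Real.exp_pos _).ne']

theorem isBoundaryOf_bdry₂ (hr : 0 < r) (hd : r < d) : (bdry₂ d r).IsBoundaryOf (D₂ d r) := by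
  set E := Real.exp (sPar d r) with hEdef
  have hE : 0 < E := Real.exp_pos _
  have himg : circleMap 0 E '' Set.Ioc (-Real.pi) Real.pi = Metric.sphere 0 E := by
    have := (periodic_circleMap (0 : ℂ) E).image_Ioc Real.two_pi_pos (-Real.pi)
    rw [show -Real.pi + 2 * Real.pi = Real.pi by ring] at this
    rw [this, range_circleMap, abs_of_pos hE]
  have hnorm : ∀ t, ‖circleMap 0 E t‖ = E := fun t ↦ by rw [norm_circleMap_zero, abs_of_pos hE]
  refine ⟨?_, contDiff_circleMap 0 E, fun t ↦ ?_, ?_, ?_, fun t _ ↦ ?_⟩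
  · have := injOn_circleMap_of_abs_sub_le (c := 0) hE.ne' (a := -Real.pi) (b := Real.pi)
      (by rw [abs_le]; constructor <;> linarith [Real.pi_pos])
    rwa [Set.uIoc_of_le (by linarith [Real.pi_pos])] at this
  · exact deriv_circleMap_ne_zero hE.ne'
  · rw [frontier_D₂ hr hd]; exact himg.subset
  · rw [frontier_D₂ hr hd]
    have : Metric.sphere (0 : ℂ) E \ (bdry₂ d r).γ '' (bdry₂ d r).I = ∅ :=
      Set.sdiff_eq_empty.2 himg.superset
    rw [this]
    exact Set.finite_empty
  · have hn : (bdry₂ d r).normalAt t = circleMap 0 E t / E := by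
      have : deriv (bdry₂ d r).γ t = circleMap 0 E t * Complex.I := deriv_circleMap 0 E t
      rw [Curve.normalAt, this, norm_mul, hnorm, Complex.norm_I, mul_one]
      congr 1
      linear_combination (-circleMap 0 E t) * Complex.I_mul_I
    have hline : ∀ s : ℝ, 0 ≤ 1 + s / E →
        ‖circleMap 0 E t + s * (circleMap 0 E t / E)‖ = E + s := fun s hs ↦ by
      have : circleMap 0 E t + s * (circleMap 0 E t / E) =
          ((1 + s / E : ℝ) : ℂ) * circleMap 0 E t := by push_cast; ring
      rw [this, norm_mul, hnorm, Complex.norm_real, Real.norm_of_nonneg hs]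
      field_simp
    filter_upwards [Ioo_mem_nhdsGT hE] with τ hτ
    have hτE : 0 ≤ 1 + (-τ) / E := by
      rw [neg_div, ← sub_eq_add_neg, sub_nonneg, div_le_one hE]
      exact hτ.2.le
    have h1 := hline (-τ) hτE
    have h2 := hline τ (by have := hτ.1; positivity)
    rw [D₂_eq_ball hr hd, hn, mem_ball_zero_iff, mem_ball_zero_iff]
    change ‖circleMap 0 E t - τ * _‖ < E ∧ ¬ ‖circleMap 0 E t + τ * _‖ < E
    rw [h2]
    rw [Complex.ofReal_neg, neg_mul, ← sub_eq_add_neg] at h1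
    rw [h1]
    constructor <;> linarith [hτ.1]

theorem bdry₂_ae_mem_sphere :
    ∀ᵐ x ∂(bdry₂ d r).σ, x ∈ Metric.sphere (0 : ℂ) (Real.exp (sPar d r)) := by
  have hm : Measurable (bdry₂ d r).γ := (continuous_circleMap _ _).measurable
  rw [Curve.σ, ae_map_iff (p := (· ∈ Metric.sphere (0 : ℂ) (Real.exp (sPar d r))))
    hm.aemeasurable Metric.isClosed_sphere.measurableSet]
  exact Eventually.of_forall fun t ↦ circleMap_mem_sphere 0 (Real.exp_pos _).le t

theorem bdry₂_isFiniteMeasure : IsFiniteMeasure (bdry₂ d r).σ := by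
  have : IsFiniteMeasure ((volume.restrict (bdry₂ d r).I).withDensity
      fun t ↦ ENNReal.ofReal ‖deriv (bdry₂ d r).γ t‖) := by
    refine isFiniteMeasure_withDensity_ofReal ?_
    have hd : ∀ t, deriv (bdry₂ d r).γ t = circleMap 0 (Real.exp (sPar d r)) t * Complex.I :=
      deriv_circleMap 0 _
    simp only [hd, norm_mul, norm_circleMap_zero, Complex.norm_I]
    exact (integrableOn_const (by simp [bdry₂])).2
  unfold Curve.σ
  infer_instance

end SecondBoundary

theorem exists_holderBump {h₀ : ℝ → ℝ} (hC1 : ContDiff ℝ 1 h₀)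
    (hHolder : ∃ (η K : NNReal), 0 < η ∧ HolderWith K η (deriv h₀))
    (hsupp : ∃ R : ℝ, 0 < R ∧ tsupport h₀ ⊆ Set.Icc (-R) R) :
    ∃ R M K η : ℝ, HolderBump (fun t ↦ h₀ (-t)) R M K η := by
  obtain ⟨η, K, hη, hK⟩ := hHolder
  obtain ⟨R, hR, hsub⟩ := hsupp
  have hcs : HasCompactSupport h₀ := isCompact_Icc.of_isClosed_subset (isClosed_tsupport _) hsub
  obtain ⟨M₁, h1⟩ := hC1.continuous.bounded_above_of_compact_support hcs
  obtain ⟨M₂, h2⟩ := hC1.continuous_deriv_one.bounded_above_of_compact_support hcs.deriv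
  have hdiff : Differentiable ℝ h₀ := hC1.differentiable (by norm_num)
  have hder : ∀ t, deriv (fun t ↦ h₀ (-t)) t = -deriv h₀ (-t) := fun t ↦ deriv_comp_neg h₀ t
  refine ⟨R, max M₁ M₂, K, η, hC1.comp contDiff_neg, hR, by exact_mod_cast hη,
    fun t ↦ (h1 _).trans (le_max_left _ _), fun t ↦ ?_, fun t ht ↦ ?_, fun t s ↦ ?_⟩
  · rw [hder, abs_neg]
    exact (h2 _).trans (le_max_right _ _)
  · refine image_eq_zero_of_notMem_tsupport fun h ↦ absurd (hsub h) fun hI ↦ ?_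
    exact absurd (abs_le.2 hI) (by rw [abs_neg, not_le]; exact ht)
  · -- mean value inequality for `h₀` minus its tangent line at `-t`
    have hd : ∀ x ∈ Set.uIcc (-s) (-t),
        DifferentiableAt ℝ (fun x ↦ h₀ x - deriv h₀ (-t) * x) x :=
      fun x _ ↦ (hdiff x).sub (differentiableAt_id.const_mul _)
    have hb : ∀ x ∈ Set.uIcc (-s) (-t),
        ‖deriv (fun x ↦ h₀ x - deriv h₀ (-t) * x) x‖ ≤ K * |t - s| ^ (η : ℝ) := fun x hx ↦ by
      have e : deriv (fun x ↦ h₀ x - deriv h₀ (-t) * x) x = deriv h₀ x - deriv h₀ (-t) :=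
        (((hdiff x).hasDerivAt.sub ((hasDerivAt_id x).const_mul (deriv h₀ (-t)))).congr_deriv
          (by simp)).deriv
      rw [e, ← dist_eq_norm]
      refine (hK.dist_le x (-t)).trans ?_
      gcongr
      rw [Real.dist_eq]
      have := Set.abs_sub_le_of_uIcc_subset_uIcc (Set.uIcc_subset_uIcc_right hx)
      rw [abs_sub_comm]
      refine this.trans_eq ?_
      rw [abs_sub_comm]
      congr 1
      ring
    have := (convex_uIcc (-s) (-t)).norm_image_sub_le_of_norm_deriv_le hd hb
      Set.left_mem_uIcc Set.right_mem_uIcc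
    rw [hder, Real.rpow_add_one' (abs_nonneg _) (by positivity), ← mul_assoc]
    have e1 : ‖-t - -s‖ = |t - s| := by rw [Real.norm_eq_abs, abs_sub_comm]; congr 1; ring
    rw [e1, Real.norm_eq_abs] at this
    refine le_trans (le_of_eq ?_) this
    congr 1
    ring

end Plasmon

/-! ### Elimination of the first density -/

namespace Plasmon

namespace Curve

variable {C C₁ C₂ : Curve}

theorem eventually_S_add {φ ψ : ℂ → ℂ} (hφ : Integrable φ C.σ) (hψ : Integrable ψ C.σ)
    {ε L : ℝ} (hε : 0 < ε) {x : ℂ} (hx : ∀ᵐ y ∂C.σ, ε ≤ ‖x - y‖) (hL : ∀ᵐ y ∂C.σ, ‖y‖ ≤ L) :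
    C.S (φ + ψ) =ᶠ[𝓝 x] C.S φ + C.S ψ := by
  filter_upwards [Metric.ball_mem_nhds x (half_pos hε)] with z hz
  have hz' : ∀ᵐ y ∂C.σ, ε / 2 ≤ ‖z - y‖ := by
    filter_upwards [hx] with y hy
    rw [Metric.mem_ball, dist_eq_norm] at hz
    have := norm_sub_le (z - y) (z - x)
    rw [sub_sub_sub_cancel_left] at this
    linarith
  simp only [S, Pi.add_apply, mul_add]
  exact integral_add (C.integrable_fundSol_mul hφ (half_pos hε) hz' hL)
    (C.integrable_fundSol_mul hψ (half_pos hε) hz' hL)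

theorem S_congr {φ ψ : ℂ → ℂ} (h : φ =ᵐ[C.σ] ψ) : C.S φ = C.S ψ :=
  funext fun x ↦ integral_congr_ae (h.mono fun y hy ↦ by simp only [hy])

theorem dn_add {f g : ℂ → ℂ} {x : ℂ} (hf : DifferentiableAt ℝ f x)
    (hg : DifferentiableAt ℝ g x) : C.dn (fun y ↦ f y + g y) x = C.dn f x + C.dn g x := by
  simp only [dn, fderiv_fun_add hf hg, add_apply]

/-- Elimination of the first density from the coupled system.  The boundaries are at a positive
distance `ε`, so each single layer potential is smooth on the other boundary.  That `∂u/∂ν₁` is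
square integrable is a consequence of the first equation, all other terms of which are. -/
theorem reduced_equation [IsFiniteMeasure C₁.σ] [IsFiniteMeasure C₂.σ] {X₁ X₂ : Set ℂ}
    (h₁ : ∀ᵐ x ∂C₁.σ, x ∈ X₁) (h₂ : ∀ᵐ x ∂C₂.σ, x ∈ X₂) {ε L : ℝ} (hε : 0 < ε)
    (hsep : ∀ x ∈ X₁, ∀ y ∈ X₂, ε ≤ ‖x - y‖) (hL₁ : ∀ x ∈ X₁, ‖x‖ ≤ L) (hL₂ : ∀ x ∈ X₂, ‖x‖ ≤ L)
    {l l' : ℂ} (hinv : C₁.ShiftInvertible l) {u φ₁ φ₂ : ℂ → ℂ}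
    (hu₁ : ∀ x ∈ X₁, DifferentiableAt ℝ u x) (hu₂ : ∀ x ∈ X₂, DifferentiableAt ℝ u x)
    (hφ₁ : MemLp φ₁ 2 C₁.σ) (hφ₂ : MemLp φ₂ 2 C₂.σ) (hdn : MemLp (C₁.dn (C₂.S φ₂)) 2 C₁.σ)
    (e₁ : C₁.shift l φ₁ =ᵐ[C₁.σ] C₁.dn fun x ↦ u x + C₂.S φ₂ x)
    (e₂ : C₂.shift l' φ₂ =ᵐ[C₂.σ] C₂.dn fun x ↦ u x + C₁.S φ₁ x) :
    MemLp (C₁.dn u) 2 C₁.σ ∧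
      (∀ x ∈ X₂, DifferentiableAt ℝ (C₁.S (C₁.shiftInv l (C₁.dn (C₂.S φ₂)))) x ∧
        DifferentiableAt ℝ (corrected C₁ l u) x) ∧
      (fun x ↦ l' * φ₂ x - opA C₁ C₂ l φ₂ x) =ᵐ[C₂.σ] C₂.dn (corrected C₁ l u) := by
  have hn₁ : ∀ᵐ y ∂C₁.σ, ‖y‖ ≤ L := h₁.mono hL₁
  have hn₂ : ∀ᵐ y ∂C₂.σ, ‖y‖ ≤ L := h₂.mono hL₂
  have hs₁ : ∀ x ∈ X₁, ∀ᵐ y ∂C₂.σ, ε ≤ ‖x - y‖ := fun x hx ↦ h₂.mono (hsep x hx)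
  have hs₂ : ∀ x ∈ X₂, ∀ᵐ y ∂C₁.σ, ε ≤ ‖x - y‖ := fun x hx ↦ h₁.mono fun y hy ↦ by
    rw [norm_sub_rev]; exact hsep y hy x hx
  have hd₁ : ∀ φ, MemLp φ 2 C₁.σ → ∀ x ∈ X₂, DifferentiableAt ℝ (C₁.S φ) x := fun φ hφ x hx ↦
    (C₁.hasFDerivAt_S (hφ.integrable (by norm_num)) hε (hs₂ x hx) hn₁).differentiableAt
  have hd₂ : ∀ x ∈ X₁, DifferentiableAt ℝ (C₂.S φ₂) x := fun x hx ↦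
    (C₂.hasFDerivAt_S (hφ₂.integrable (by norm_num)) hε (hs₁ x hx) hn₂).differentiableAt
  have e₁' : C₁.shift l φ₁ =ᵐ[C₁.σ] C₁.dn u + C₁.dn (C₂.S φ₂) := by
    filter_upwards [e₁, h₁] with x hx hx1
    rw [hx, Pi.add_apply, dn_add (hu₁ x hx1) (hd₂ x hx1)]
  have hdu : MemLp (C₁.dn u) 2 C₁.σ := by
    refine MemLp.ae_eq ?_ (((hφ₁.const_mul l).sub (hinv.memLp φ₁ hφ₁)).sub hdn)
    filter_upwards [e₁'] with x hx
    rw [shift, Pi.add_apply] at hx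
    simp only [Pi.sub_apply]
    linear_combination hx
  obtain ⟨mu, -⟩ := hinv.shiftInv_spec hdu
  obtain ⟨mS, -⟩ := hinv.shiftInv_spec hdn
  have hsplit := hinv.ae_eq_shiftInv_add hφ₁ hdu hdn e₁'
  refine ⟨hdu, fun x hx ↦ ⟨hd₁ _ mS x hx, (hu₂ x hx).add (hd₁ _ mu x hx)⟩, ?_⟩
  filter_upwards [e₂, h₂] with x hx hx2
  have hS : C₁.S φ₁ =ᶠ[𝓝 x]
      C₁.S (C₁.shiftInv l (C₁.dn u)) + C₁.S (C₁.shiftInv l (C₁.dn (C₂.S φ₂))) := by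
    rw [S_congr hsplit]
    exact eventually_S_add (mu.integrable (by norm_num)) (mS.integrable (by norm_num)) hε
      (hs₂ x hx2) hn₁
  have htot : C₂.dn (fun x ↦ u x + C₁.S φ₁ x) x =
      C₂.dn (corrected C₁ l u) x + C₂.dn (C₁.S (C₁.shiftInv l (C₁.dn (C₂.S φ₂)))) x := by
    have hcongr : (fun x ↦ u x + C₁.S φ₁ x) =ᶠ[𝓝 x]
        fun x ↦ corrected C₁ l u x + C₁.S (C₁.shiftInv l (C₁.dn (C₂.S φ₂))) x := by
      filter_upwards [hS] with y hy
      rw [hy, corrected, Pi.add_apply, add_assoc]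
    have hcor : DifferentiableAt ℝ (corrected C₁ l u) x := (hu₂ x hx2).add (hd₁ _ mu x hx2)
    rw [← dn_add hcor (hd₁ _ mS x hx2), dn, dn, hcongr.fderiv_eq]
  rw [shift, htot] at hx
  rw [opA]
  linear_combination hx

end Curve

end Plasmon

theorem proposition3p1 (d r : ℝ) (hr : 0 < r) (hd : r < d)
    (h₀ : ℝ → ℝ) (hC1 : ContDiff ℝ 1 h₀)
    (hHolder : ∃ (η K : NNReal), 0 < η ∧ HolderWith K η (deriv h₀))
    (hsupp : ∃ R : ℝ, 0 < R ∧ tsupport h₀ ⊆ Set.Icc (-R) R) :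
    ∃ δ₀ : ℝ, 0 < δ₀ ∧ ∀ δ : ℝ, 0 < δ → δ < δ₀ →
      ∀ C₁ C₂ : Plasmon.Curve, C₁ = Plasmon.bdry₁ d r h₀ δ → C₂ = Plasmon.bdry₂ d r →
      C₁.IsBoundaryOf (Plasmon.D₁ d r h₀ δ) ∧ C₂.IsBoundaryOf (Plasmon.D₂ d r) ∧
      ∀ εm εp : ℝ, 0 < εm → 0 < εp → εm ≠ εp →
        C₁.ShiftInvertible (Plasmon.contrast εm εp) ∧
        ∀ (εc : ℂ) (a₁ a₂ : ℝ) (φ₁ φ₂ : ℂ → ℂ), εc ≠ εp →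
          MemLp φ₁ 2 C₁.σ → MemLp φ₂ 2 C₂.σ →
          -- the coupled integral system for the densities
          C₁.shift (Plasmon.contrast εm εp) φ₁ =ᵐ[C₁.σ]
            C₁.dn (fun x => Plasmon.uIncT d r a₁ a₂ x + C₂.S φ₂ x) →
          C₂.shift (Plasmon.contrast εp εc) φ₂ =ᵐ[C₂.σ]
            C₂.dn (fun x => Plasmon.uIncT d r a₁ a₂ x + C₁.S φ₁ x) →
          -- the inverse is applied to elements of L² only
          MemLp (C₁.dn (Plasmon.uIncT d r a₁ a₂)) 2 C₁.σ ∧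
          MemLp (C₁.dn (C₂.S φ₂)) 2 C₁.σ ∧
          -- the normal derivatives on the boundary of D₂ exist
          (∀ x ∈ frontier (Plasmon.D₂ d r),
            DifferentiableAt ℝ (C₁.S (C₁.shiftInv (Plasmon.contrast εm εp)
              (C₁.dn (C₂.S φ₂)))) x ∧
            DifferentiableAt ℝ (Plasmon.corrected C₁ (Plasmon.contrast εm εp)
              (Plasmon.uIncT d r a₁ a₂)) x) ∧
          -- the equation for φ₂
          (fun x => Plasmon.contrast εp εc * φ₂ x -
              Plasmon.opA C₁ C₂ (Plasmon.contrast εm εp) φ₂ x) =ᵐ[C₂.σ]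
            C₂.dn (Plasmon.corrected C₁ (Plasmon.contrast εm εp)
              (Plasmon.uIncT d r a₁ a₂)) := by
  open Plasmon in
  obtain ⟨R, M, K, η, hk⟩ := exists_holderBump hC1 hHolder hsupp
  have hM0 : 0 ≤ M := hk.bound_nonneg
  have hc := focus_pos hr hd
  obtain ⟨B, hB⟩ := hk.exists_isSchurKernel
    (lo := 2 * focus d r / (1 + 9 * focus d r ^ 2 / 4))
    (hi := 2 * focus d r * (1 + M) * (1 + 4 / focus d r ^ 2)) (by positivity) (by positivity)
  refine ⟨min 1 (min (focus d r / 2 / (M + 1)) (min ((d - r) / 2 / (M + 1)) (1 / 2 / (B + 1)))),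
    ?_, fun δ hδ hδ₀ C₁ C₂ hC₁ hC₂ ↦ ?_⟩
  · have : 0 < d - r := sub_pos.2 hd
    positivity
  rw [lt_min_iff, lt_min_iff, lt_min_iff] at hδ₀
  obtain ⟨hδ1, hδ2, hδ3, hδ4⟩ := hδ₀
  rw [lt_div_iff₀ (by positivity)] at hδ2 hδ3 hδ4
  lift δ to ℝ≥0 using hδ.le
  have hM : δ * M ≤ focus d r / 2 := by nlinarith
  have hm : δ * M ≤ (d - r) / 2 := by nlinarith
  have hδB : ((δ * B : ℝ≥0) : ℝ) < 1 / 2 := by push_cast; nlinarith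
  obtain ⟨ε, hε, hdisj⟩ := (disjoint_sphere_collar hr hd (m := (d - r) / 2) (by linarith)
    (by linarith)).exists_thickenings (isCompact_sphere _ _) (isCompact_collar _ _ _).isClosed
  have hsep : ∀ x ∈ Set.range C₁.γ, ∀ y ∈ frontier (D₂ d r), ε ≤ ‖x - y‖ := by
    rintro _ ⟨t, rfl⟩ y hy
    rw [frontier_D₂ hr hd] at hy
    by_contra! h
    have hγ : C₁.γ t ∈ collar d r ((d - r) / 2) := by
      rw [hC₁]; exact bdry₁_mem_collar hk hδ.le hc hM hm t
    refine Set.disjoint_left.1 hdisj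
      (Metric.mem_thickening_iff.2 ⟨y, hy, ?_⟩) (Metric.self_subset_thickening hε _ hγ)
    rwa [dist_eq_norm]
  have hemb : MeasurableEmbedding C₁.γ := by
    rw [hC₁]; exact bdry₁_measurableEmbedding hk hδ.le hc hM
  have hfin : IsFiniteMeasure (densityMeasure fun t ↦ ‖deriv C₁.γ t‖) := by
    rw [hC₁]; exact bdry₁_isFiniteMeasure hk hδ.le hδ1.le hc hM
  have hσ : C₁.σ = Measure.map C₁.γ (densityMeasure fun t ↦ ‖deriv C₁.γ t‖) := by
    rw [hC₁]; exact bdry₁_σ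
  have hfin₁ : IsFiniteMeasure C₁.σ := by rw [hσ]; infer_instance
  have hfin₂ : IsFiniteMeasure C₂.σ := by rw [hC₂]; exact bdry₂_isFiniteMeasure
  have hae₁ : ∀ᵐ x ∂C₁.σ, x ∈ Set.range C₁.γ := by
    rw [hσ, hemb.ae_map_iff]; exact Eventually.of_forall fun t ↦ Set.mem_range_self t
  have hae₂ : ∀ᵐ x ∂C₂.σ, x ∈ frontier (D₂ d r) := by
    rw [hC₂, frontier_D₂ hr hd]; exact bdry₂_ae_mem_sphere
  have hL₁ : ∀ x ∈ Set.range C₁.γ, ‖x‖ ≤ max 5 (Real.exp (sPar d r)) := by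
    rintro _ ⟨t, rfl⟩
    rw [hC₁]
    exact (mem_closedBall_zero_iff.1 (bdry₁_mem_collar hk hδ.le hc hM hm t).1).trans
      (le_max_left _ _)
  have hL₂ : ∀ x ∈ frontier (D₂ d r), ‖x‖ ≤ max 5 (Real.exp (sPar d r)) := fun x hx ↦ by
    rw [frontier_D₂ hr hd, mem_sphere_zero_iff_norm] at hx
    exact hx.le.trans (le_max_right _ _)
  have hu₁ : ∀ a₁ a₂, ∀ x ∈ Set.range C₁.γ, DifferentiableAt ℝ (uIncT d r a₁ a₂) x := by
    rintro a₁ a₂ _ ⟨t, rfl⟩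
    rw [hC₁]
    exact differentiableAt_uIncT (Phi_ne_one hc _) a₁ a₂
  have hu₂ : ∀ a₁ a₂, ∀ x ∈ frontier (D₂ d r), DifferentiableAt ℝ (uIncT d r a₁ a₂) x := by
    intro a₁ a₂ x hx
    refine differentiableAt_uIncT ?_ a₁ a₂
    rintro rfl
    rw [frontier_D₂ hr hd, mem_sphere_zero_iff_norm, norm_one] at hx
    exact (one_lt_exp_sPar hr hd).ne hx
  refine ⟨?_, ?_, fun εm εp hεm hεp hne ↦ ?_⟩
  · rw [hC₁]; exact isBoundaryOf_bdry₁ hC1 hk hδ.le hc hM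
  · rw [hC₂]; exact isBoundaryOf_bdry₂ hr hd
  have hl := norm_contrast hεm hεp hne
  have hinv : C₁.ShiftInvertible (contrast εm εp) := by
    rw [hC₁]
    refine bdry₁_shiftInvertible hk hδ1.le hc hM (hB δ) (hδB.trans hl) fun h ↦ ?_
    rw [h] at hl
    norm_num at hl
  refine ⟨hinv, fun εc a₁ a₂ φ₁ φ₂ _ hφ₁ hφ₂ e₁ e₂ ↦ ?_⟩
  have hdn : MemLp (C₁.dn (C₂.S φ₂)) 2 C₁.σ := by
    refine Curve.memLp_dn hemb ?_ hσ ?_ fun t ↦ C₂.norm_fderiv_S_le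
      (hφ₂.integrable (by norm_num)) hε (hae₂.mono (hsep _ ⟨t, rfl⟩)) (hae₂.mono hL₂)
    · rw [hC₁]; exact bdry₁_contDiff hk hδ.le hc hM
    · rw [hC₁]; exact bdry₁_ν hk hδ.le hc hM
  obtain ⟨r1, r2, r3⟩ := Curve.reduced_equation hae₁ hae₂ hε hsep hL₁ hL₂ hinv (hu₁ a₁ a₂)
    (hu₂ a₁ a₂) hφ₁ hφ₂ hdn e₁ e₂
  exact ⟨r1, hdn, r2, r3⟩
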